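/- Let $F$ be one of $\mathbb R,\mathbb C,\mathbb H$ (real, complex, quaternion entries) and put $\beta=1,2,4$ respectively. Let $R=[\rho_{jk}]_{j,k=1}^N$ be a random correlation matrix with entries in $F$, that is, a positive definite Hermitian $N\times N$ matrix with all diagonal entries equal to $1$, whose distribution has density $$\frac{1}{C}(\det R)^a,\qquad a>-1,$$ with respect to Lebesgue measure on the real components (there are $\beta$ of them per entry) of the strictly upper triangular entries, where $C$ is the normalisation (which satisfies $0<C<\infty$). In the quaternion case, $\det R$ is the square root of the determinant of the $2N\times 2N$ complex matrix obtained by replacing each quaternion entry by its block $\begin{bmatrix} z&w\\-\overline w&\overline z\end{bmatrix}$, and positive definiteness is that of this complex matrix. Write $B(x,y)=\Gamma(x)\Gamma(y)/\Gamma(x+y)$. Then for all $j\ne k$ the real part $\rho$ of the off-diagonal entry $\rho_{jk}$ has probability density function $$\frac{1}{B\left(a+\frac{\beta(N-1)+1}{2},\frac12\right)}\,(1-\rho^2)^{a+\frac{\beta(N-1)-1}{2}},\qquad |\rho|<1,$$ and zero for $|\rho|\ge 1$. Moreover, for every real $s$ with $a+s>-1$, $(\det R)^s$ is integrable and $$\mathbb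 E(\det R)^s=\prod_{k=1}^{N-1}\prod_{l=0}^{\beta-1}\left(\frac{B\left(a+s+\frac{\beta k+1-l}{2},\frac12\right)}{B\left(a+\frac{\beta k+1-l}{2},\frac12\right)}\right)^k .$$ -/

import Mathlib

open MeasureTheory

open scoped ComplexOrder

noncomputable section

namespace CorrMat

/-- The type of the matrix entries: real, complex or quaternion. -/
inductive EntryType where
  | real
  | complex
  | quaternion

/-- The number of real components of an entry: 1, 2, 4. -/
def EntryType.beta : EntryType → ℕ
  | .real => 1
  | .complex => 2
  | .quaternion => 4

/-- The real components of the strictly upper triangular entries of an `N × N` matrix, each entry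
having `b` real components. The volume on this space is the product Lebesgue measure. -/
abbrev Coord (N b : ℕ) : Type := {p : Fin N × Fin N // p.1 < p.2} → Fin b → ℝ

/-- The Hermitian `N × N` matrix with unit diagonal whose strictly upper triangular entries have the
real components `x`, where `e` assembles an entry from its components. -/
def hermitianOf {A : Type} [Ring A] [StarRing A] {N b : ℕ} (e : (Fin b → ℝ) → A) (x : Coord N b) :
    Matrix (Fin N) (Fin N) A :=
  Matrix.of fun j k =>
    if h : j < k then e (x ⟨(j, k), h⟩)
    else if h : k < j then star (e (x ⟨(k, j), h⟩))
    else 1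

/-- The real symmetric matrix with unit diagonal and upper entries `x`. -/
def realMatrix {N : ℕ} (x : Coord N 1) : Matrix (Fin N) (Fin N) ℝ :=
  hermitianOf (fun v => v 0) x

/-- The complex Hermitian matrix with unit diagonal and upper entries `x`. -/
def complexMatrix {N : ℕ} (x : Coord N 2) : Matrix (Fin N) (Fin N) ℂ :=
  hermitianOf (fun v => (⟨v 0, v 1⟩ : ℂ)) x

/-- The quaternion Hermitian matrix with unit diagonal and upper entries `x`. -/
def quaternionMatrix {N : ℕ} (x : Coord N 4) : Matrix (Fin N) (Fin N) (Quaternion ℝ) :=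
  hermitianOf (fun v => (⟨v 0, v 1, v 2, v 3⟩ : Quaternion ℝ)) x

/-- The representation of a quaternion as the `2 × 2` complex matrix `[z, w; -conj w, conj z]`. -/
def quaternionBlock (q : Quaternion ℝ) : Matrix (Fin 2) (Fin 2) ℂ :=
  !![⟨q.re, q.imI⟩, ⟨q.imJ, q.imK⟩;
    -(starRingEnd ℂ) ⟨q.imJ, q.imK⟩, (starRingEnd ℂ) ⟨q.re, q.imI⟩]

/-- The `2N × 2N` complex matrix obtained by replacing each quaternion entry by its block. -/
def complexify {N : ℕ} (M : Matrix (Fin N) (Fin N) (Quaternion ℝ)) :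
    Matrix (Fin N × Fin 2) (Fin N × Fin 2) ℂ :=
  Matrix.of fun p q => quaternionBlock (M p.1 q.1) p.2 q.2

/-- The set of coordinates of correlation matrices (positive definite, unit diagonal). In the
quaternion case positive definiteness is that of the complex representation. -/
def corrSet : (F : EntryType) → (N : ℕ) → Set (Coord N F.beta)
  | .real, _ => {x | (realMatrix x).PosDef}
  | .complex, _ => {x | (complexMatrix x).PosDef}
  | .quaternion, _ => {x | (complexify (quaternionMatrix x)).PosDef}

/-- The determinant of the Hermitian matrix with coordinates `x`. In the complex case the
determinant is a real number, viewed here in `ℝ`. In the quaternion case it is the square root of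
the (real) determinant of the complex representation. -/
def detR : (F : EntryType) → {N : ℕ} → Coord N F.beta → ℝ
  | .real, _, x => (realMatrix x).det
  | .complex, _, x => (complexMatrix x).det.re
  | .quaternion, _, x => Real.sqrt (complexify (quaternionMatrix x)).det.re

/-- The real part of the entry in row `j` and column `k`. -/
def entryRe : (F : EntryType) → {N : ℕ} → Fin N → Fin N → Coord N F.beta → ℝ
  | .real, _, j, k, x => realMatrix x j k
  | .complex, _, j, k, x => (complexMatrix x j k).re
  | .quaternion, _, j, k, x => (quaternionMatrix x j k).re

/-- The measure `(det R)^a (dR)` on the space of correlation matrices. -/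
def weightMeasure (F : EntryType) (N : ℕ) (a : ℝ) : Measure (Coord N F.beta) :=
  (volume.restrict (corrSet F N)).withDensity fun x => ENNReal.ofReal (detR F x ^ a)

/-- The law of the random correlation matrix with density proportional to `(det R)^a`: the measure
`(det R)^a (dR)` divided by its total mass. -/
def corrMeasure (F : EntryType) (N : ℕ) (a : ℝ) : Measure (Coord N F.beta) :=
  (weightMeasure F N a Set.univ)⁻¹ • weightMeasure F N a

end CorrMat

end

/-! Replace every entry by the real `b × b` matrix of left multiplication by it, with `b = β`. The
Hermitian matrix becomes a real symmetric matrix `gram`. On the positive definite set its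
determinant is `(det R)^b`, so one argument serves all three algebras.

Let `G` be the upper left corner and `v` the real vector of the last column. Left multiplications
commute with right multiplications, and the right multiplications `R d` satisfy Hurwitz relations.
Hence the Schur complement of `G` is scalar, `(1 - q) • 1` with `q = vᵀ G⁻¹ v`
(`HurwitzFrame.schur`). So the matrix is positive definite iff `G` is and `q < 1`, and the density
factors as `weight R a G * (1 - q)^a` (`HurwitzFrame.weight_succ`).

Substituting `v = L u` with `L Lᵀ = G` turns the ellipsoid `q < 1` into the unit ball. The Jacobian
`√det G` shifts `a` to `a + b/2`, and what remains is a ball integral in dimension `N b`, a product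
of beta values. Iterating gives the normalisation constant `Z(a)`, and the moment of order `s` is
`Z(a + s) / Z(a)`.

For an entry of the last column, the unit diagonal of `G` allows a choice of `L` that keeps the
relevant coordinate of `v`, so its law is that of one coordinate in the ball. Any other entry lies
in the corner and is handled by induction: the exponent `a + (b(N - 1) - 1)/2` does not change when
`N` drops by one and `a` grows by `b/2`. -/

namespace CorrMat

open Matrix

/-! ### Truncated powers and one-dimensional beta integrals -/

/-- The function `(1 - r)^c` on `r < 1`, extended by zero. -/
noncomputable def bump (c r : ℝ) : ENNReal := if r < 1 then ENNReal.ofReal ((1 - r) ^ c) else 0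

@[fun_prop]
lemma measurable_bump (c : ℝ) : Measurable (bump c) :=
  Measurable.ite measurableSet_Iio (by fun_prop) measurable_const

lemma bump_zero_right (c : ℝ) : bump c 0 = 1 := by simp [bump]

/-- Rests on `1 - (s + (1 - s) r) = (1 - s)(1 - r)`; this is what separates variables when a ball is
sliced. -/
lemma bump_add_mul (c : ℝ) {s r : ℝ} (hs : s < 1) :
    bump c (s + (1 - s) * r) = bump c s * bump c r := by
  have h1 : 0 < 1 - s := by linarith
  have h2 : s + (1 - s) * r < 1 ↔ r < 1 := by
    constructor
    · intro h; by_contra! h'; nlinarith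
    · intro h; nlinarith
  unfold bump
  simp only [h2, hs, if_true]
  split_ifs with hr
  · rw [← ENNReal.ofReal_mul (Real.rpow_nonneg h1.le _),
      ← Real.mul_rpow h1.le (by linarith)]
    ring_nf
  · simp

lemma bump_of_one_le (c : ℝ) {r : ℝ} (h : 1 ≤ r) : bump c r = 0 := by
  simp [bump, not_lt.2 h]

lemma bump_mul_bump (c d : ℝ) (r : ℝ) : bump c r * bump d r = bump (c + d) r := by
  unfold bump
  split_ifs with h
  · rw [← ENNReal.ofReal_mul (Real.rpow_nonneg (by linarith) _), ← Real.rpow_add (by linarith)]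
  · simp

/-- Legendre duplication, for the beta function. -/
lemma beta_self_eq {x : ℝ} (hx : 0 < x) :
    2 * 4 ^ (x - 1) * ProbabilityTheory.beta x x = ProbabilityTheory.beta x (1 / 2) := by
  have h := Real.Gamma_mul_Gamma_add_half x
  have h1 : 0 < Real.Gamma x := Real.Gamma_pos_of_pos hx
  have h2 : 0 < Real.Gamma (x + 1 / 2) := Real.Gamma_pos_of_pos (by linarith)
  have h3 : 0 < Real.Gamma (2 * x) := Real.Gamma_pos_of_pos (by linarith)
  have h4 : (4 : ℝ) ^ (x - 1) * 2 * (2 : ℝ) ^ (1 - 2 * x) = 1 := by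
    rw [show (4 : ℝ) ^ (x - 1) * 2 = 2 ^ (2 * x - 1) by
      rw [show (4 : ℝ) = 2 ^ (2 : ℝ) by norm_num, ← Real.rpow_mul (by norm_num),
        ← Real.rpow_add_one (by norm_num)]
      ring_nf, ← Real.rpow_add (by norm_num)]
    ring_nf
    simp
  unfold ProbabilityTheory.beta
  rw [Real.Gamma_one_half_eq, ← two_mul, mul_div_assoc', div_eq_div_iff h3.ne' h2.ne']
  calc 2 * 4 ^ (x - 1) * (Real.Gamma x * Real.Gamma x) * Real.Gamma (x + 1 / 2)
      = 2 * 4 ^ (x - 1) * Real.Gamma x * (Real.Gamma x * Real.Gamma (x + 1 / 2)) := by ring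
    _ = (4 ^ (x - 1) * 2 * 2 ^ (1 - 2 * x)) * (Real.Gamma x * √Real.pi * Real.Gamma (2 * x)) := by
      rw [h]; ring
    _ = _ := by rw [h4, one_mul]

/-- With `t = 2p - 1` one has `1 - t² = 4p(1 - p)`, so the integrand is a multiple of a symmetric
beta density; duplication then rewrites `B(c+1, c+1)`. -/
lemma lintegral_bump_sq {c : ℝ} (hc : -1 < c) :
    ∫⁻ t : ℝ, bump c (t ^ 2) = ENNReal.ofReal (ProbabilityTheory.beta (c + 1) (1 / 2)) := by
  have hc' : 0 < c + 1 := by linarith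
  have hB : 0 < ProbabilityTheory.beta (c + 1) (c + 1) := ProbabilityTheory.beta_pos hc' hc'
  have h1 := ProbabilityTheory.lintegral_betaPDF_eq_one hc' hc'
  have key : ∀ t : ℝ, bump c (t ^ 2) =
      ENNReal.ofReal (4 ^ c * ProbabilityTheory.beta (c + 1) (c + 1)) *
        ProbabilityTheory.betaPDF (c + 1) (c + 1) (2⁻¹ * t + 2⁻¹) := by
    intro t
    rw [ProbabilityTheory.betaPDF_eq, ← ENNReal.ofReal_mul (by positivity), bump]
    have hiff : (0 < 2⁻¹ * t + 2⁻¹ ∧ 2⁻¹ * t + 2⁻¹ < 1) ↔ t ^ 2 < 1 := by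
      rw [sq_lt_one_iff_abs_lt_one, abs_lt]
      constructor <;> rintro ⟨h, h'⟩ <;> constructor <;> linarith
    simp only [hiff]
    split_ifs with h
    · obtain ⟨h0, h1⟩ := hiff.2 h
      congr 1
      have : 1 - t ^ 2 = 4 * (2⁻¹ * t + 2⁻¹) * (1 - (2⁻¹ * t + 2⁻¹)) := by ring
      rw [this, Real.mul_rpow (by positivity) (by linarith), Real.mul_rpow (by norm_num) h0.le]
      field_simp
      simp
    · simp
  simp_rw [key]
  rw [lintegral_const_mul' _ _ ENNReal.ofReal_ne_top]
  have h2 : ∫⁻ t : ℝ, ProbabilityTheory.betaPDF (c + 1) (c + 1) (2⁻¹ * t + 2⁻¹) = 2 := by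
    have hm : Measurable (fun t : ℝ => ProbabilityTheory.betaPDF (c + 1) (c + 1) (t + 2⁻¹)) := by
      unfold ProbabilityTheory.betaPDF; fun_prop
    have := Real.map_volume_mul_left (a := (2⁻¹ : ℝ)) (by norm_num)
    have h3 : ∫⁻ t, ProbabilityTheory.betaPDF (c + 1) (c + 1) (t + 2⁻¹)
        ∂(Measure.map (fun x => (2⁻¹ : ℝ) * x) volume) = 2 := by
      rw [this, lintegral_smul_measure,
        lintegral_add_right_eq_self (fun t => ProbabilityTheory.betaPDF (c + 1) (c + 1) t), h1]
      simp
    rwa [lintegral_map hm (by fun_prop)] at h3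
  rw [h2, ← beta_self_eq hc', show (2 : ENNReal) = ENNReal.ofReal 2 by simp,
    ← ENNReal.ofReal_mul (by positivity)]
  congr 1
  rw [add_sub_cancel_right]
  ring

/-! ### Integrals over the unit ball -/

/-- The integral of `(1 - |u|²)^a` over the unit ball of dimension `n`. -/
noncomputable def ballInt (n : ℕ) (a : ℝ) : ENNReal := ∫⁻ u : Fin n → ℝ, bump a (∑ i, u i ^ 2)

/-- The slice at height `t` is a ball of radius `√(1 - t²)`. Rescaling it contributes the volume
factor `(1 - t²)^(n/2)`. -/
lemma lintegral_bump_slice (n : ℕ) (a t : ℝ) :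
    ∫⁻ w : Fin n → ℝ, bump a (t ^ 2 + ∑ i, w i ^ 2) = ballInt n a * bump (a + n / 2) (t ^ 2) := by
  by_cases ht : t ^ 2 < 1
  · have hp : 0 < 1 - t ^ 2 := by linarith
    set ρ := √(1 - t ^ 2) with hρ
    have hρ0 : 0 < ρ := Real.sqrt_pos.2 hp
    have hρ2 : ρ ^ 2 = 1 - t ^ 2 := Real.sq_sqrt hp.le
    have hm : Measurable fun w : Fin n → ℝ => bump a (t ^ 2 + ∑ i, w i ^ 2) := by fun_prop
    have h1 : ∫⁻ w : Fin n → ℝ, bump a (t ^ 2 + ∑ i, w i ^ 2)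
        ∂(Measure.map (fun w => ρ • w) volume) = bump a (t ^ 2) * ballInt n a := by
      rw [lintegral_map hm (by fun_prop), ballInt, ← lintegral_const_mul _ (by fun_prop)]
      refine lintegral_congr fun w => ?_
      rw [← bump_add_mul a ht]
      simp only [Pi.smul_apply, smul_eq_mul, mul_pow, hρ2, Finset.mul_sum]
    have h2 := Measure.map_addHaar_smul (volume : Measure (Fin n → ℝ)) hρ0.ne'
    rw [h2, lintegral_smul_measure, Module.finrank_fin_fun, smul_eq_mul] at h1
    have h3 : bump (n / 2 : ℝ) (t ^ 2) = ENNReal.ofReal (ρ ^ n) := by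
      rw [bump, if_pos ht, hρ, Real.sqrt_eq_rpow, ← Real.rpow_mul_natCast hp.le]
      congr 2; ring
    rw [← bump_mul_bump, ← mul_assoc, mul_comm (ballInt n a), ← h1, h3, mul_right_comm,
      ← ENNReal.ofReal_mul (by positivity), abs_of_pos (by positivity),
      inv_mul_cancel₀ (by positivity)]
    simp
  · push Not at ht
    rw [bump_of_one_le _ ht, mul_zero, lintegral_eq_zero_iff (by fun_prop)]
    refine .of_forall fun w => bump_of_one_le _ ?_
    have : 0 ≤ ∑ i, w i ^ 2 := Finset.sum_nonneg fun i _ => sq_nonneg _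
    linarith

lemma lintegral_bump_mul_head (n : ℕ) (a : ℝ) {f : ℝ → ENNReal} (hf : Measurable f) :
    ∫⁻ u : Fin (n + 1) → ℝ, bump a (∑ i, u i ^ 2) * f (u 0) =
      ballInt n a * ∫⁻ t, bump (a + n / 2) (t ^ 2) * f t := by
  have hmp := (volume_preserving_piFinSuccAbove (fun _ : Fin (n + 1) => ℝ) 0).symm
  rw [← hmp.lintegral_comp (by fun_prop)]
  rw [Measure.volume_eq_prod, lintegral_prod _ (by fun_prop), ← lintegral_const_mul _ (by fun_prop)]
  refine lintegral_congr fun t => ?_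
  simp only [MeasurableEquiv.piFinSuccAbove_symm_apply, Fin.insertNthEquiv_zero,
    Fin.consEquiv_apply, Fin.cons_zero, Fin.sum_univ_succ, Fin.cons_succ]
  rw [lintegral_mul_const _ (by fun_prop), lintegral_bump_slice, mul_assoc]

lemma ballInt_zero (a : ℝ) : ballInt 0 a = 1 := by
  simp [ballInt, bump_zero_right, lintegral_const, volume_pi]

lemma ballInt_succ (n : ℕ) {a : ℝ} (ha : -1 < a) :
    ballInt (n + 1) a =
      ballInt n a * ENNReal.ofReal (ProbabilityTheory.beta (a + n / 2 + 1) (1 / 2)) := by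
  have h := lintegral_bump_mul_head n a (f := fun _ => 1) measurable_const
  simp only [mul_one] at h
  have hn : (0 : ℝ) ≤ n := n.cast_nonneg
  rw [lintegral_bump_sq (by linarith)] at h
  exact h

lemma ballInt_eq_prod (n : ℕ) {a : ℝ} (ha : -1 < a) :
    ballInt n a = ENNReal.ofReal
      (∏ m ∈ Finset.range n, ProbabilityTheory.beta (a + m / 2 + 1) (1 / 2)) := by
  induction n with
  | zero => simp [ballInt_zero]
  | succ n ih =>
    rw [ballInt_succ n ha, ih, Finset.prod_range_succ, ENNReal.ofReal_mul]
    refine Finset.prod_nonneg fun m _ => (ProbabilityTheory.beta_pos ?_ (by norm_num)).le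
    have : (0 : ℝ) ≤ m := m.cast_nonneg
    linarith

/-! ### Integrals over ellipsoids -/

section

variable {ι : Type*} [Fintype ι] [DecidableEq ι]

lemma lintegral_eq_abs_det_mul_lintegral_mulVec {L : Matrix ι ι ℝ} (hL : L.det ≠ 0)
    {g : (ι → ℝ) → ENNReal} (hg : Measurable g) :
    ∫⁻ v, g v = ENNReal.ofReal |L.det| * ∫⁻ u, g (L *ᵥ u) := by
  have h := Real.map_matrix_volume_pi_eq_smul_volume_pi hL
  have hm : Measurable (Matrix.toLin' L) :=
    (Matrix.toLin' L).continuous_of_finiteDimensional.measurable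
  have h1 : ∫⁻ u, g (L *ᵥ u) = ∫⁻ v, g v ∂(Measure.map (Matrix.toLin' L) volume) := by
    rw [lintegral_map hg hm]; simp
  rw [h1, h, lintegral_smul_measure, smul_eq_mul, ← mul_assoc,
    ← ENNReal.ofReal_mul (abs_nonneg _), ← abs_mul, mul_inv_cancel₀ hL]
  simp

lemma exists_mul_transpose_eq {S : Matrix ι ι ℝ} (hS : S.PosDef) :
    ∃ L : Matrix ι ι ℝ, L * Lᵀ = S := by
  open scoped MatrixOrder in
  obtain ⟨B, hB⟩ := CStarAlgebra.nonneg_iff_eq_star_mul_self.mp hS.posSemidef.nonneg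
  refine ⟨Bᵀ, ?_⟩
  rw [hB, Matrix.transpose_transpose, Matrix.star_eq_conjTranspose,
    Matrix.conjTranspose_eq_transpose_of_trivial]

/-- A factorization `S = L Lᵀ` in which the row `i`, a unit vector, is the standard one. -/
lemma exists_mul_transpose_eq_of_diag_eq_one {S : Matrix ι ι ℝ} (hS : S.PosDef) (i : ι)
    (hi : S i i = 1) :
    ∃ L : Matrix ι ι ℝ, L * Lᵀ = S ∧ ∀ j, L i j = (1 : Matrix ι ι ℝ) i j := by
  obtain ⟨B, hB⟩ := exists_mul_transpose_eq hS
  -- Row `i` of any factor `B` has squared norm `S i i = 1`. Complete it to an orthonormal basis and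
  -- rotate by the transposed basis matrix; the rotation leaves `B Bᵀ` unchanged and sends that row
  -- to the standard one.
  let r : ι → EuclideanSpace ℝ ι := fun _ => WithLp.toLp 2 (B i)
  have hr : Orthonormal ℝ (({i} : Set ι).domRestrict r) := by
    rw [orthonormal_iff_ite]
    rintro ⟨j, rfl⟩ ⟨k, rfl⟩
    simp only [if_true, ← hi, ← hB]
    simp only [r, Set.domRestrict_apply, PiLp.inner_apply, Matrix.mul_apply, Matrix.transpose_apply]
    rfl
  obtain ⟨b, hb⟩ := hr.exists_orthonormalBasis_extension_of_card_eq (by simp)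
  have hbi : b i = WithLp.toLp 2 (B i) := hb i rfl
  let O : Matrix ι ι ℝ := Matrix.of fun j k => b j k
  have hO : O * Oᵀ = 1 := by
    ext j k
    have := orthonormal_iff_ite.1 b.orthonormal k j
    rw [Matrix.one_apply]
    simp only [PiLp.inner_apply] at this
    simp only [Matrix.mul_apply, O, Matrix.transpose_apply, Matrix.of_apply]
    convert! this using 1
    simp [eq_comm]
  have hO' : Oᵀ * O = 1 := mul_eq_one_comm.1 hO
  refine ⟨B * Oᵀ, ?_, fun j => ?_⟩
  · rw [Matrix.transpose_mul, Matrix.transpose_transpose, Matrix.mul_assoc, ← Matrix.mul_assoc Oᵀ,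
      hO', Matrix.one_mul, hB]
  · rw [← hO, Matrix.mul_apply, Matrix.mul_apply]
    simp [O, hbi]

lemma dotProduct_inv_mulVec_mulVec {S L : Matrix ι ι ℝ} (hS : S.PosDef) (hL : L * Lᵀ = S)
    (u : ι → ℝ) : (L *ᵥ u) ⬝ᵥ (S⁻¹ *ᵥ (L *ᵥ u)) = ∑ i, u i ^ 2 := by
  have hd : IsUnit L.det := by
    have := hS.det_pos
    rw [← hL, Matrix.det_mul] at this
    exact (left_ne_zero_of_mul this.ne').isUnit
  have hd' : IsUnit Lᵀ.det := by rwa [Matrix.det_transpose]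
  rw [← hL, Matrix.mul_inv_rev, ← Matrix.mulVec_mulVec, Matrix.mulVec_mulVec u,
    Matrix.nonsing_inv_mul _ hd, Matrix.one_mulVec,
    ← Matrix.vecMul_transpose L, ← Matrix.dotProduct_mulVec, Matrix.mulVec_mulVec,
    Matrix.mul_nonsing_inv _ hd',
    Matrix.one_mulVec]
  simp [dotProduct, sq]

lemma abs_det_eq_sqrt {S L : Matrix ι ι ℝ} (hL : L * Lᵀ = S) : |L.det| = √S.det := by
  rw [← hL, Matrix.det_mul, Matrix.det_transpose, Real.sqrt_mul_self_eq_abs]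

lemma lintegral_bump_inv {S : Matrix ι ι ℝ} (hS : S.PosDef) (a : ℝ) :
    ∫⁻ v, bump a (v ⬝ᵥ (S⁻¹ *ᵥ v)) =
      ENNReal.ofReal √S.det * ballInt (Fintype.card ι) a := by
  obtain ⟨L, hL⟩ := exists_mul_transpose_eq hS
  have hd : L.det ≠ 0 := by
    have := hS.det_pos
    rw [← hL, Matrix.det_mul] at this
    exact left_ne_zero_of_mul this.ne'
  have hm : Measurable fun v => bump a (v ⬝ᵥ (S⁻¹ *ᵥ v)) :=
    (measurable_bump a).comp (Continuous.measurable (by fun_prop))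
  rw [lintegral_eq_abs_det_mul_lintegral_mulVec hd hm, abs_det_eq_sqrt hL]
  simp_rw [dotProduct_inv_mulVec_mulVec hS hL]
  congr 1
  have hmp := volume_measurePreserving_piCongrLeft (fun _ : Fin (Fintype.card ι) => ℝ)
    (Fintype.equivFin ι)
  rw [ballInt, ← hmp.lintegral_comp (by fun_prop)]
  refine lintegral_congr fun u => ?_
  rw [← (Fintype.equivFin ι).sum_comp]
  simp [MeasurableEquiv.piCongrLeft]

/-- Row `i` of the chosen factor `L` is standard, so `v = L u` gives `v i = u i`: the ellipsoid
becomes a ball while the tested coordinate stays put. -/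
lemma lintegral_bump_inv_mul {S : Matrix ι ι ℝ} (hS : S.PosDef) (a : ℝ) (i : ι) (hi : S i i = 1)
    {n : ℕ} (hn : Fintype.card ι = n + 1) {f : ℝ → ENNReal} (hf : Measurable f) :
    ∫⁻ v, bump a (v ⬝ᵥ (S⁻¹ *ᵥ v)) * f (v i) =
      ENNReal.ofReal √S.det * (ballInt n a * ∫⁻ t, bump (a + n / 2) (t ^ 2) * f t) := by
  obtain ⟨L, hL, hLi⟩ := exists_mul_transpose_eq_of_diag_eq_one hS i hi
  have hd : L.det ≠ 0 := by
    have := hS.det_pos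
    rw [← hL, Matrix.det_mul] at this
    exact left_ne_zero_of_mul this.ne'
  have hm : Measurable fun v => bump a (v ⬝ᵥ (S⁻¹ *ᵥ v)) * f (v i) :=
    ((measurable_bump a).comp (Continuous.measurable (by fun_prop))).mul
      (hf.comp (measurable_pi_apply i))
  rw [lintegral_eq_abs_det_mul_lintegral_mulVec hd hm, abs_det_eq_sqrt hL]
  have hLi' : ∀ u, (L *ᵥ u) i = u i := fun u => by
    simp [Matrix.mulVec, dotProduct, hLi, Matrix.one_apply]
  simp_rw [dotProduct_inv_mulVec_mulVec hS hL, hLi']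
  congr 1
  obtain ⟨e, he⟩ : ∃ e : ι ≃ Fin (n + 1), e i = 0 := by
    let e := Fintype.equivFinOfCardEq hn
    exact ⟨e.trans (Equiv.swap (e i) 0), by simp⟩
  have hmp := volume_measurePreserving_piCongrLeft (fun _ : Fin (n + 1) => ℝ) e
  rw [← lintegral_bump_mul_head n a hf, ← hmp.lintegral_comp (by fun_prop)]
  refine lintegral_congr fun u => ?_
  rw [← e.sum_comp, ← he]
  simp [MeasurableEquiv.piCongrLeft]

end

/-! ### The real symmetric model and its Schur complement -/

open scoped Kronecker

section

variable {b : ℕ}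

/-- The matrix whose columns are the images of `u` under the matrices `R d`. If `R d` is the right
multiplication by the `d`-th basis element of an algebra, this is the left multiplication by `u`. -/
def leftMul (R : Fin b → Matrix (Fin b) (Fin b) ℝ) (u : Fin b → ℝ) : Matrix (Fin b) (Fin b) ℝ :=
  Matrix.of fun c d => (R d *ᵥ u) c

/-- The Hurwitz relations satisfied by the right multiplications by the basis elements
of the real, complex and quaternion algebras, and associativity. -/
structure HurwitzFrame [NeZero b] (R : Fin b → Matrix (Fin b) (Fin b) ℝ) : Prop where
  zero : R 0 = 1
  anticomm : ∀ c d, (R c)ᵀ * R d + (R d)ᵀ * R c = if c = d then (2 : ℝ) • 1 else 0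
  comm : ∀ u d, Commute (leftMul R u) (R d)

/-- The real symmetric matrix representing the Hermitian matrix with coordinates `x`. -/
def gram (R : Fin b → Matrix (Fin b) (Fin b) ℝ) {N : ℕ} (x : Coord N b) :
    Matrix (Fin N × Fin b) (Fin N × Fin b) ℝ :=
  Matrix.of fun p q =>
    if h : p.1 < q.1 then leftMul R (x ⟨(p.1, q.1), h⟩) p.2 q.2
    else if h : q.1 < p.1 then leftMul R (x ⟨(q.1, p.1), h⟩) q.2 p.2
    else (1 : Matrix (Fin b) (Fin b) ℝ) p.2 q.2

/-- The coordinates of the upper left corner. -/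
def initCoord {N : ℕ} (y : Coord (N + 1) b) : Coord N b :=
  fun p => y ⟨(p.1.1.castSucc, p.1.2.castSucc), Fin.castSucc_lt_castSucc_iff.2 p.2⟩

/-- The coordinates of the last column. -/
def lastCol {N : ℕ} (y : Coord (N + 1) b) : Fin N × Fin b → ℝ :=
  fun p => y ⟨(p.1.castSucc, Fin.last N), Fin.castSucc_lt_last _⟩ p.2

/-- The quadratic form of the inverse matrix. -/
noncomputable def invForm (R : Fin b → Matrix (Fin b) (Fin b) ℝ) {N : ℕ} (x : Coord N b)
    (v : Fin N × Fin b → ℝ) : ℝ :=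
  v ⬝ᵥ ((gram R x)⁻¹ *ᵥ v)

/-- Splitting off the last index. -/
noncomputable def lastEquiv (N b : ℕ) : (Fin N × Fin b) ⊕ Fin b ≃ Fin (N + 1) × Fin b :=
  Equiv.ofBijective
    (Sum.elim (fun p => (p.1.castSucc, p.2)) fun c => (Fin.last N, c)) <| by
    constructor
    · rintro (⟨i, c⟩ | c) (⟨j, d⟩ | d) h <;> simp_all
      exact (Fin.castSucc_lt_last j).ne h.1.symm
    · rintro ⟨i, c⟩
      refine Fin.lastCases ⟨.inr c, rfl⟩ (fun i => ⟨.inl (i, c), rfl⟩) i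

@[simp] lemma lastEquiv_inl (N b : ℕ) (p : Fin N × Fin b) :
    lastEquiv N b (.inl p) = (p.1.castSucc, p.2) := rfl

@[simp] lemma lastEquiv_inr (N b : ℕ) (c : Fin b) :
    lastEquiv N b (.inr c) = (Fin.last N, c) := rfl

variable (R : Fin b → Matrix (Fin b) (Fin b) ℝ) {N : ℕ}

lemma gram_diag (x : Coord N b) (p : Fin N × Fin b) : gram R x p p = 1 := by
  simp [gram]

lemma gram_transpose (x : Coord N b) : (gram R x)ᵀ = gram R x := by
  ext ⟨i, c⟩ ⟨j, d⟩
  rcases lt_trichotomy i j with h | h | h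
  · simp [gram, h, h.not_gt]
  · subst h; simp [gram, Matrix.one_apply, eq_comm]
  · simp [gram, h, h.not_gt]

/-- The last block column. -/
def lastBlock (v : Fin N × Fin b → ℝ) : Matrix (Fin N × Fin b) (Fin b) ℝ :=
  Matrix.of fun p d => (((1 : Matrix (Fin N) (Fin N) ℝ) ⊗ₖ R d) *ᵥ v) p

lemma one_kronecker_mulVec (A : Matrix (Fin b) (Fin b) ℝ) (v : Fin N × Fin b → ℝ)
    (p : Fin N × Fin b) :
    (((1 : Matrix (Fin N) (Fin N) ℝ) ⊗ₖ A) *ᵥ v) p = (A *ᵥ fun c => v (p.1, c)) p.2 := by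
  simp [Matrix.mulVec, dotProduct, Fintype.sum_prod_type, Matrix.one_apply]

lemma gram_submatrix_lastEquiv (y : Coord (N + 1) b) :
    (gram R y).submatrix (lastEquiv N b) (lastEquiv N b) =
      fromBlocks (gram R (initCoord y)) (lastBlock R (lastCol y)) (lastBlock R (lastCol y))ᴴ 1 := by
  ext (⟨i, c⟩ | c) (⟨j, d⟩ | d)
  · simp [gram, initCoord]
  · simp [gram, lastBlock, one_kronecker_mulVec, lastCol, leftMul, Fin.castSucc_lt_last]
  · simp [gram, lastBlock, one_kronecker_mulVec, lastCol, leftMul, Fin.castSucc_lt_last,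
      (Fin.castSucc_lt_last j).not_gt]
  · simp [gram]

variable {R} [NeZero b]

lemma HurwitzFrame.transpose_mul_self (hR : HurwitzFrame R) (d : Fin b) : (R d)ᵀ * R d = 1 := by
  have h := hR.anticomm d d
  rw [if_pos rfl, ← two_smul ℝ] at h
  exact smul_right_injective _ (two_ne_zero' ℝ) h

/-- `R d` is orthogonal, so commuting with it means commuting with its inverse `(R d)ᵀ`; then
transpose. -/
lemma HurwitzFrame.comm_transpose (hR : HurwitzFrame R) (u : Fin b → ℝ) (d : Fin b) :
    Commute (leftMul R u)ᵀ (R d) := by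
  have h1 := hR.transpose_mul_self d
  have h2 : R d * (R d)ᵀ = 1 := mul_eq_one_comm.1 h1
  have h3 : (R d)ᵀ * leftMul R u = leftMul R u * (R d)ᵀ := by
    calc (R d)ᵀ * leftMul R u = (R d)ᵀ * (leftMul R u * R d) * (R d)ᵀ := by
          rw [Matrix.mul_assoc, Matrix.mul_assoc, h2, Matrix.mul_one]
      _ = leftMul R u * (R d)ᵀ := by
          rw [(hR.comm u d).eq, ← Matrix.mul_assoc, h1, Matrix.one_mul]
  have h4 := congrArg Matrix.transpose h3
  simpa [Commute, SemiconjBy] using h4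

/-- Each block is a left multiplication, the transpose of one, or the identity, and all of these
commute with `R d`. -/
lemma HurwitzFrame.gram_comm (hR : HurwitzFrame R) (x : Coord N b) (d : Fin b) :
    Commute (gram R x) ((1 : Matrix (Fin N) (Fin N) ℝ) ⊗ₖ R d) := by
  have key : ∀ i j, Commute (Matrix.of fun c e => gram R x (i, c) (j, e)) (R d) := by
    intro i j
    rcases lt_trichotomy i j with h | h | h
    · convert! hR.comm (x ⟨(i, j), h⟩) d using 1
      ext c e; simp [gram, h]
    · subst h
      convert! Commute.one_left (R d) using 1
      ext c e; simp [gram]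
    · convert! hR.comm_transpose (x ⟨(j, i), h⟩) d using 1
      ext c e; simp [gram, h, h.not_gt]
  ext ⟨i, c⟩ ⟨j, e⟩
  have := congrFun (congrFun (key i j).eq c) e
  simpa [Matrix.mul_apply, Fintype.sum_prod_type, Matrix.one_apply] using this

/-- Write `T d` for the block diagonal copy of `R d`, so that column `d` of the last block is `T d
v`. Since `S` commutes with `(T c)ᵀ`, entry `(c, d)` is `vᵀ S (T c)ᵀ (T d) v`. It is symmetric in
`c, d`, hence half of an expression in `(T c)ᵀ T d + (T d)ᵀ T c`, which the Hurwitz relations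
evaluate. -/
lemma HurwitzFrame.schur (hR : HurwitzFrame R) {x : Coord N b} (hx : (gram R x).PosDef)
    (v : Fin N × Fin b → ℝ) :
    (lastBlock R v)ᴴ * (gram R x)⁻¹ * lastBlock R v = invForm R x v • 1 := by
  set S := (gram R x)⁻¹ with hS
  let T : Fin b → Matrix (Fin N × Fin b) (Fin N × Fin b) ℝ :=
    fun d => (1 : Matrix (Fin N) (Fin N) ℝ) ⊗ₖ R d
  have hST : Sᵀ = S := by rw [hS, Matrix.transpose_nonsing_inv, gram_transpose]
  have hcomm : ∀ d, Commute S (T d) := fun d => by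
    have h1 : S * gram R x = 1 := Matrix.nonsing_inv_mul _ hx.det_pos.ne'.isUnit
    have h2 : gram R x * S = 1 := Matrix.mul_nonsing_inv _ hx.det_pos.ne'.isUnit
    calc S * T d = S * (T d * gram R x) * S := by
          rw [Matrix.mul_assoc, Matrix.mul_assoc, h2, Matrix.mul_one]
      _ = T d * S := by
          rw [← (hR.gram_comm x d).eq, ← Matrix.mul_assoc, h1, Matrix.one_mul]
  have hcomm' : ∀ d, (T d)ᵀ * S = S * (T d)ᵀ := fun d => by
    have := congrArg Matrix.transpose (hcomm d).eq
    simpa [hST] using this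
  have hT : ∀ c d, (T c)ᵀ * T d + (T d)ᵀ * T c = if c = d then (2 : ℝ) • 1 else 0 := by
    intro c d
    have h := congrArg (fun A => (1 : Matrix (Fin N) (Fin N) ℝ) ⊗ₖ A) (hR.anticomm c d)
    have hT' : ∀ c d, (T c)ᵀ * T d = (1 : Matrix (Fin N) (Fin N) ℝ) ⊗ₖ ((R c)ᵀ * R d) := by
      intro c d
      simp only [T]
      rw [← Matrix.kroneckerMap_transpose, Matrix.transpose_one, ← Matrix.mul_kronecker_mul,
        Matrix.one_mul]
    simp only [Matrix.kronecker_add] at h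
    rw [hT', hT', h]
    split_ifs
    · rw [Matrix.kronecker_smul, Matrix.one_kronecker_one]
    · simp
  have hval : ∀ c d, ((lastBlock R v)ᴴ * S * lastBlock R v) c d =
      v ⬝ᵥ ((S * ((T c)ᵀ * T d)) *ᵥ v) := by
    intro c d
    rw [← Matrix.mul_assoc, ← hcomm', Matrix.mul_assoc, ← Matrix.mulVec_mulVec,
      ← Matrix.mulVec_mulVec, Matrix.dotProduct_mulVec, Matrix.vecMul_transpose,
      Matrix.mul_apply]
    rfl
  have hsymm : ∀ c d, ((lastBlock R v)ᴴ * S * lastBlock R v) c d =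
      ((lastBlock R v)ᴴ * S * lastBlock R v) d c := by
    intro c d
    have : ((lastBlock R v)ᴴ * S * lastBlock R v)ᵀ = (lastBlock R v)ᴴ * S * lastBlock R v := by
      simp [hST, Matrix.mul_assoc, Matrix.conjTranspose_eq_transpose_of_trivial]
    exact congrFun (congrFun this d) c
  ext c d
  have h2 : 2 * ((lastBlock R v)ᴴ * S * lastBlock R v) c d = 2 * (invForm R x v • 1 :
      Matrix (Fin b) (Fin b) ℝ) c d := by
    rw [two_mul]
    nth_rw 2 [hsymm]
    rw [hval, hval, ← dotProduct_add, ← Matrix.add_mulVec, ← Matrix.mul_add, hT]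
    split_ifs with h
    · subst h
      simp [invForm, hS, Matrix.smul_mulVec]
    · simp [h]
  linarith

lemma HurwitzFrame.det_gram (hR : HurwitzFrame R) {y : Coord (N + 1) b}
    (hy : (gram R (initCoord y)).PosDef) :
    (gram R y).det =
      (gram R (initCoord y)).det * (1 - invForm R (initCoord y) (lastCol y)) ^ b := by
  have : Invertible (gram R (initCoord y)) := hy.isUnit.invertible
  rw [← Matrix.det_submatrix_equiv_self (lastEquiv N b), gram_submatrix_lastEquiv,
    Matrix.det_fromBlocks₁₁, Matrix.invOf_eq_nonsing_inv, hR.schur hy]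
  congr 1
  have h1 (r : ℝ) : (1 : Matrix (Fin b) (Fin b) ℝ) - r • 1 = (1 - r) • 1 := by
    rw [sub_smul, one_smul]
  rw [h1, Matrix.det_smul, Matrix.det_one, Fintype.card_fin, mul_one]

lemma HurwitzFrame.posDef_gram_iff (hR : HurwitzFrame R) (y : Coord (N + 1) b) :
    (gram R y).PosDef ↔
      (gram R (initCoord y)).PosDef ∧ invForm R (initCoord y) (lastCol y) < 1 := by
  have h1 (r : ℝ) : (1 : Matrix (Fin b) (Fin b) ℝ) - r • 1 = Matrix.diagonal fun _ => 1 - r := by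
    rw [← Matrix.diagonal_one, ← Matrix.diagonal_smul, Matrix.diagonal_sub]
    simp
  have hsub : (gram R y).PosDef → (gram R (initCoord y)).PosDef := fun h => by
    have := h.submatrix (e := fun p : Fin N × Fin b => lastEquiv N b (.inl p))
      ((lastEquiv N b).injective.comp Sum.inl_injective)
    convert! this
  refine ⟨fun h => ⟨hsub h, ?_⟩, fun ⟨h, hq⟩ => ?_⟩
  · have hi := hsub h
    have : Invertible (gram R (initCoord y)) := hi.isUnit.invertible
    have h2 := h.posSemidef.submatrix (lastEquiv N b)
    rw [gram_submatrix_lastEquiv, PosDef.fromBlocks₁₁ _ _ hi, hR.schur hi, h1,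
      posSemidef_diagonal_iff] at h2
    have h3 := h.det_pos
    rw [hR.det_gram hi] at h3
    -- The Schur criterion for semidefiniteness gives only `q ≤ 1`; equality would make the
    -- determinant vanish, as `b ≠ 0`.
    refine lt_of_le_of_ne (by simpa using h2 0) fun h4 => ?_
    simp [h4, NeZero.ne b] at h3
  · have : Invertible (gram R (initCoord y)) := h.isUnit.invertible
    have h2 : (gram R y).PosSemidef := by
      rw [← Matrix.posSemidef_submatrix_equiv (lastEquiv N b), gram_submatrix_lastEquiv,
        PosDef.fromBlocks₁₁ _ _ h, hR.schur h, h1, posSemidef_diagonal_iff]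
      intro _; linarith
    rw [h2.posDef_iff_isUnit, Matrix.isUnit_iff_isUnit_det, hR.det_gram h]
    exact (mul_pos h.det_pos (pow_pos (by linarith) _)).ne'.isUnit

end

/-! ### Rearranging products of beta values -/

/-- Cut the range into blocks of length `b` and reverse each one: `m = b k + (b - 1 - l)` gives `m/2
+ 1 = (b(k + 1) + 1 - l)/2`. -/
lemma prod_range_mul_eq (B : ℝ → ℝ) (a : ℝ) (b n : ℕ) :
    ∏ m ∈ Finset.range (n * b), B (a + m / 2 + 1) =
      ∏ k ∈ Finset.range n, ∏ l ∈ Finset.range b,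
        B (a + ((b : ℝ) * ((k + 1 : ℕ) : ℝ) + 1 - (l : ℝ)) / 2) := by
  induction n with
  | zero => simp
  | succ n ih =>
    rw [Nat.succ_mul, Finset.prod_range_add, ih, Finset.prod_range_succ]
    congr 1
    rw [← Finset.prod_range_reflect]
    refine Finset.prod_congr rfl fun l hl => ?_
    have h : l + 1 ≤ b := Finset.mem_range.1 hl
    have h2 : b - 1 - l = b - (l + 1) := by omega
    rw [h2]
    push_cast [h]
    congr 1
    ring

/-- Bookkeeping for the recursion: replacing `a` by `a + b/2` moves the factor of index `k` to index
`k + 1`, and the new ball integral supplies each factor once more. -/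
lemma prod_pow_shift (W : ℕ → ℝ) (n : ℕ) :
    ∏ k ∈ Finset.range n, W (k + 1) ^ (k + 1) =
      (∏ k ∈ Finset.range (n - 1), W (k + 2) ^ (k + 1)) * ∏ k ∈ Finset.range n, W (k + 1) := by
  cases n with
  | zero => simp
  | succ n =>
    simp_rw [pow_succ, Finset.prod_mul_distrib]
    rw [Finset.prod_range_succ' (fun k => W (k + 1) ^ k)]
    simp [pow_succ, Finset.prod_mul_distrib]

lemma prod_Icc_one (f : ℕ → ℝ) (n : ℕ) :
    ∏ k ∈ Finset.Icc 1 n, f k = ∏ k ∈ Finset.range n, f (k + 1) := by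
  rw [Finset.range_eq_Ico, Finset.prod_Ico_add' f 0 n 1]
  rfl

lemma prod_beta_pow_pos (N b : ℕ) {a : ℝ} (ha : -1 < a) :
    0 < ∏ k ∈ Finset.Icc 1 (N - 1), ∏ l ∈ Finset.range b,
      ProbabilityTheory.beta (a + ((b : ℝ) * (k : ℝ) + 1 - (l : ℝ)) / 2) (1 / 2) ^ k := by
  refine Finset.prod_pos fun k hk => Finset.prod_pos fun l hl => pow_pos ?_ _
  refine ProbabilityTheory.beta_pos ?_ (by norm_num)
  have h1 : (b : ℝ) * 1 ≤ b * k :=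
    mul_le_mul_of_nonneg_left (by exact_mod_cast (Finset.mem_Icc.1 hk).1) b.cast_nonneg
  have h2 : (l : ℝ) + 1 ≤ b := by exact_mod_cast Finset.mem_range.1 hl
  linarith

/-! ### Integrating out the last column -/

open scoped Classical in
/-- The density `(det)^a` on the set of correlation matrices, extended by zero. -/
noncomputable def weight {b : ℕ} (R : Fin b → Matrix (Fin b) (Fin b) ℝ) {N : ℕ} (a : ℝ)
    (x : Coord N b) : ENNReal :=
  -- The exponent is `a / b` because the determinant of `gram` is the `b`-th power of the
  -- determinant of the Hermitian matrix.
  if (gram R x).PosDef then ENNReal.ofReal ((gram R x).det ^ (a / b)) else 0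

section

variable {b : ℕ} (R : Fin b → Matrix (Fin b) (Fin b) ℝ) {N : ℕ}

lemma continuous_gram : Continuous fun x : Coord N b => gram R x := by
  refine continuous_matrix fun p q => ?_
  by_cases h : p.1 < q.1
  · simp only [gram, leftMul, Matrix.of_apply, h, dif_pos]; fun_prop
  · by_cases h' : q.1 < p.1
    · simp only [gram, leftMul, Matrix.of_apply, h, h', dif_pos, dif_neg, not_false_eq_true]
      fun_prop
    · simp only [gram, leftMul, Matrix.of_apply, h, h', dif_neg, not_false_eq_true]; fun_prop

lemma measurable_invForm :
    Measurable fun p : Coord N b × (Fin N × Fin b → ℝ) => invForm R p.1 p.2 := by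
  have hg : Continuous fun p : Coord N b × (Fin N × Fin b → ℝ) => gram R p.1 :=
    (continuous_gram R).comp continuous_fst
  have h : ∀ p : Coord N b × (Fin N × Fin b → ℝ), invForm R p.1 p.2 =
      ((gram R p.1).det)⁻¹ * (p.2 ⬝ᵥ ((gram R p.1).adjugate *ᵥ p.2)) := fun p => by
    rw [invForm, Matrix.inv_def, Ring.inverse_eq_inv', Matrix.smul_mulVec, dotProduct_smul,
      smul_eq_mul]
  simp_rw [h]
  refine (hg.matrix_det.measurable.inv).mul (Continuous.measurable ?_)
  exact continuous_snd.dotProduct (hg.matrix_adjugate.matrix_mulVec continuous_snd)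

lemma measurePreserving_uncurry (ι κ : Type*) [Fintype ι] [Fintype κ] :
    MeasurePreserving fun (u : ι → κ → ℝ) (p : ι × κ) => u p.1 p.2 := by
  have hm : Measurable fun (u : ι → κ → ℝ) (p : ι × κ) => u p.1 p.2 := by fun_prop
  refine ⟨hm, ?_⟩
  rw [volume_pi (ι := ι × κ)]
  refine (Measure.pi_eq fun s hs => ?_).symm
  rw [Measure.map_apply hm (MeasurableSet.univ_pi hs), Fintype.prod_prod_type]
  have h : (fun (u : ι → κ → ℝ) (p : ι × κ) => u p.1 p.2) ⁻¹' Set.univ.pi s =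
      Set.univ.pi fun i => Set.univ.pi fun k => s (i, k) := by
    ext u; simp
  rw [h, volume_pi_pi]
  simp_rw [volume_pi_pi]

/-- A position above the diagonal lies in the upper left corner or in the last column. -/
noncomputable def upperEquiv (N : ℕ) :
    {p : Fin N × Fin N // p.1 < p.2} ⊕ Fin N ≃ {p : Fin (N + 1) × Fin (N + 1) // p.1 < p.2} :=
  Equiv.ofBijective
    (Sum.elim (fun p => ⟨(p.1.1.castSucc, p.1.2.castSucc), Fin.castSucc_lt_castSucc_iff.2 p.2⟩)
      fun i => ⟨(i.castSucc, Fin.last N), Fin.castSucc_lt_last i⟩) <| by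
    constructor
    · rintro (⟨⟨i, k⟩, h⟩ | i) (⟨⟨j, l⟩, h'⟩ | j) h <;> simp_all
      exact (Fin.castSucc_lt_last l).ne h.2.symm
    · rintro ⟨⟨i, k⟩, h⟩
      obtain ⟨i, rfl⟩ := Fin.exists_castSucc_eq.2 (h.trans_le (Fin.le_last k)).ne
      induction k using Fin.lastCases with
      | last => exact ⟨.inr i, rfl⟩
      | cast k => exact ⟨.inl ⟨(i, k), h⟩, rfl⟩

lemma measurePreserving_split (N b : ℕ) :
    MeasurePreserving fun y : Coord (N + 1) b => (initCoord y, lastCol y) := by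
  have h1 := (volume_measurePreserving_piCongrLeft
    (fun _ : {p : Fin (N + 1) × Fin (N + 1) // p.1 < p.2} => Fin b → ℝ) (upperEquiv N)).symm
  have h2 := volume_measurePreserving_sumPiEquivProdPi
    (fun _ : {p : Fin N × Fin N // p.1 < p.2} ⊕ Fin N => Fin b → ℝ)
  have h3 := (MeasurePreserving.id (volume : Measure (Coord N b))).prod
    (measurePreserving_uncurry (Fin N) (Fin b))
  exact h3.comp (h2.comp h1)

/-- Lets the measurability of the positive definite set be read off from that of the weight. -/
lemma weight_ne_zero_iff (a : ℝ) (x : Coord N b) : weight R a x ≠ 0 ↔ (gram R x).PosDef := by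
  unfold weight
  split_ifs with h
  · simp only [h, iff_true, ne_eq, ENNReal.ofReal_eq_zero, not_le]
    exact Real.rpow_pos_of_pos h.det_pos _
  · simp [h]

variable [NeZero b]

/-- The Jacobian `√det = det^((b/2)/b)` is absorbed as a shift of the exponent by `b / 2`. -/
lemma lintegral_weight_fiber (a : ℝ) (x : Coord N b) :
    ∫⁻ v, weight R a x * bump a (invForm R x v) =
      weight R (a + b / 2) x * ballInt (N * b) a := by
  have hb : (b : ℝ) ≠ 0 := Nat.cast_ne_zero.2 (NeZero.ne b)
  by_cases h : (gram R x).PosDef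
  · have hm : Measurable fun v => bump a (invForm R x v) :=
      (measurable_bump a).comp ((measurable_invForm R).comp measurable_prodMk_left)
    rw [lintegral_const_mul _ hm]
    unfold invForm
    rw [lintegral_bump_inv h, ← mul_assoc]
    congr 1
    · rw [weight, weight, if_pos h, if_pos h,
        ← ENNReal.ofReal_mul (Real.rpow_nonneg h.det_pos.le _),
        Real.sqrt_eq_rpow, ← Real.rpow_add h.det_pos]
      congr 2; field_simp
    · simp
  · simp [weight, h]

lemma lintegral_weight_fiber_mul (a : ℝ) (x : Coord N b) (j : Fin N) {n : ℕ}
    (hn : N * b = n + 1) {f : ℝ → ENNReal} (hf : Measurable f) :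
    ∫⁻ v, weight R a x * bump a (invForm R x v) * f (v (j, 0)) =
      weight R (a + b / 2) x * (ballInt n a * ∫⁻ t, bump (a + n / 2) (t ^ 2) * f t) := by
  have hb : (b : ℝ) ≠ 0 := Nat.cast_ne_zero.2 (NeZero.ne b)
  by_cases h : (gram R x).PosDef
  · have hm : Measurable fun v => bump a (invForm R x v) * f (v (j, 0)) :=
      ((measurable_bump a).comp ((measurable_invForm R).comp measurable_prodMk_left)).mul
        (hf.comp (measurable_pi_apply _))
    simp_rw [mul_assoc (weight R a x)]
    rw [lintegral_const_mul _ hm]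
    unfold invForm
    rw [lintegral_bump_inv_mul h a (j, 0) (gram_diag R x _) (by simpa using hn) hf, ← mul_assoc]
    congr 1
    rw [weight, weight, if_pos h, if_pos h, ← ENNReal.ofReal_mul (Real.rpow_nonneg h.det_pos.le _),
      Real.sqrt_eq_rpow, ← Real.rpow_add h.det_pos]
    congr 2; field_simp
  · simp [weight, h]

variable {R} (hR : HurwitzFrame R)

include hR

lemma HurwitzFrame.weight_succ (a : ℝ) (y : Coord (N + 1) b) :
    weight R a y =
      weight R a (initCoord y) * bump a (invForm R (initCoord y) (lastCol y)) := by
  have hb : (b : ℝ) ≠ 0 := Nat.cast_ne_zero.2 (NeZero.ne b)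
  unfold weight bump
  rw [hR.posDef_gram_iff]
  by_cases h : (gram R (initCoord y)).PosDef
  · by_cases hq : invForm R (initCoord y) (lastCol y) < 1
    · have h1 : 0 ≤ 1 - invForm R (initCoord y) (lastCol y) := by linarith
      rw [if_pos ⟨h, hq⟩, if_pos h, if_pos hq, hR.det_gram h,
        Real.mul_rpow h.det_pos.le (pow_nonneg h1 _),
        ENNReal.ofReal_mul (Real.rpow_nonneg h.det_pos.le _), ← Real.rpow_natCast_mul h1,
        mul_div_cancel₀ _ hb]
    · simp [h, hq]
  · simp [h]

/-- The factorisation of the weight reduces measurability to that of `invForm`, one column at a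
time. -/
lemma HurwitzFrame.measurable_weight (N : ℕ) (a : ℝ) :
    Measurable (weight R a : Coord N b → ENNReal) := by
  induction N with
  | zero =>
    have : Subsingleton (Coord 0 b) := ⟨fun x y => funext fun p => p.1.1.elim0⟩
    exact measurable_of_finite _
  | succ N ih =>
    have h := (measurePreserving_split N b).measurable
    have h2 := (ih.comp measurable_fst).mul ((measurable_bump a).comp (measurable_invForm R))
    convert! h2.comp h using 1
    ext y
    exact hR.weight_succ a y

lemma HurwitzFrame.lintegral_weight_succ_mul (N : ℕ) (a : ℝ)
    {g : Coord N b → ENNReal} (hg : Measurable g) {f : (Fin N × Fin b → ℝ) → ENNReal}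
    (hf : Measurable f) :
    ∫⁻ y : Coord (N + 1) b, weight R a y * g (initCoord y) * f (lastCol y) =
      ∫⁻ x : Coord N b, g x * ∫⁻ v, weight R a x * bump a (invForm R x v) * f v := by
  have hm1 : Measurable fun p : Coord N b × (Fin N × Fin b → ℝ) =>
      weight R a p.1 * bump a (invForm R p.1 p.2) * f p.2 :=
    (((hR.measurable_weight N a).comp measurable_fst).mul
      ((measurable_bump a).comp (measurable_invForm R))).mul (hf.comp measurable_snd)
  have hm : Measurable fun p : Coord N b × (Fin N × Fin b → ℝ) =>
      g p.1 * (weight R a p.1 * bump a (invForm R p.1 p.2) * f p.2) :=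
    (hg.comp measurable_fst).mul hm1
  have h := (measurePreserving_split N b).lintegral_comp hm
  rw [Measure.volume_eq_prod, lintegral_prod _ hm.aemeasurable] at h
  convert! h using 1
  · refine lintegral_congr fun y => ?_
    rw [hR.weight_succ]; ring
  · refine lintegral_congr fun x => ?_
    exact (lintegral_const_mul _ (hm1.comp measurable_prodMk_left)).symm

lemma HurwitzFrame.lintegral_weight_succ (N : ℕ) (a : ℝ) {g : Coord N b → ENNReal}
    (hg : Measurable g) :
    ∫⁻ y : Coord (N + 1) b, weight R a y * g (initCoord y) =
      (∫⁻ x : Coord N b, weight R (a + b / 2) x * g x) * ballInt (N * b) a := by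
  have h := hR.lintegral_weight_succ_mul N a hg (f := fun _ => 1) measurable_const
  simp only [mul_one] at h
  rw [h]
  simp_rw [lintegral_weight_fiber R]
  have hm : Measurable fun x => weight R (a + b / 2) x * g x := (hR.measurable_weight N _).mul hg
  rw [← lintegral_mul_const _ hm]
  exact lintegral_congr fun x => by ring

lemma HurwitzFrame.lintegral_weight_mul_last (N : ℕ) (a : ℝ) (j : Fin N) {n : ℕ}
    (hn : N * b = n + 1) {f : ℝ → ENNReal} (hf : Measurable f) :
    ∫⁻ y : Coord (N + 1) b, weight R a y * f (lastCol y (j, 0)) =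
      (∫⁻ x : Coord N b, weight R (a + b / 2) x) * ballInt n a *
        ∫⁻ t, bump (a + n / 2) (t ^ 2) * f t := by
  have h := hR.lintegral_weight_succ_mul N a (g := fun _ => 1) measurable_const
    (f := fun v => f (v (j, 0))) (hf.comp (measurable_pi_apply _))
  simp only [mul_one, one_mul] at h
  rw [h]
  simp_rw [lintegral_weight_fiber_mul R a _ j hn hf]
  rw [lintegral_mul_const _ (hR.measurable_weight N _), mul_assoc]

/-- The normalization constant is the product of ball integrals. -/
lemma HurwitzFrame.lintegral_weight_eq (N : ℕ) {a : ℝ} (ha : -1 < a) :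
    ∫⁻ x : Coord N b, weight R a x = ENNReal.ofReal
      (∏ k ∈ Finset.Icc 1 (N - 1), ∏ l ∈ Finset.range b,
        ProbabilityTheory.beta (a + ((b : ℝ) * (k : ℝ) + 1 - (l : ℝ)) / 2) (1 / 2) ^ k) := by
  induction N generalizing a with
  | zero =>
    have : Unique (Coord 0 b) := ⟨⟨fun p => p.1.1.elim0⟩, fun x => funext fun p => p.1.1.elim0⟩
    have hw : ∀ x : Coord 0 b, weight R a x = 1 := fun x => by
      have h : (gram R x).PosDef := by
        rw [posDef_iff_dotProduct_mulVec]
        exact ⟨Subsingleton.elim _ _, fun v hv => (hv (Subsingleton.elim _ _)).elim⟩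
      simp [weight, h]
    simp [hw, volume_pi]
  | succ N ih =>
    have h := hR.lintegral_weight_succ N a (g := fun _ => 1) measurable_const
    simp only [mul_one] at h
    have hb : (0 : ℝ) ≤ b := b.cast_nonneg
    have ha' : -1 < a + b / 2 := by linarith
    rw [h, ih ha', ballInt_eq_prod _ ha, ← ENNReal.ofReal_mul (prod_beta_pow_pos N b ha').le,
      prod_range_mul_eq (fun x => ProbabilityTheory.beta x (1 / 2))]
    congr 1
    simp_rw [Finset.prod_pow]
    rw [prod_Icc_one, prod_Icc_one, Nat.add_sub_cancel]
    have h3 := prod_pow_shift (fun k => ∏ l ∈ Finset.range b,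
      ProbabilityTheory.beta (a + ((b : ℝ) * (k : ℝ) + 1 - (l : ℝ)) / 2) (1 / 2)) N
    rw [h3]
    congr 1
    refine Finset.prod_congr rfl fun k _ => ?_
    congr 1
    refine Finset.prod_congr rfl fun l _ => ?_
    congr 1
    push_cast
    ring

/-- The distribution of the real part of an entry, up to a constant. -/
lemma HurwitzFrame.exists_lintegral_weight_mul (N : ℕ) :
    ∀ (a : ℝ) (p : {p : Fin N × Fin N // p.1 < p.2}), ∃ C : ENNReal,
      ∀ f : ℝ → ENNReal, Measurable f → ∫⁻ x : Coord N b, weight R a x * f (x p 0) =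
        C * ∫⁻ t, bump (a + ((b : ℝ) * ((N : ℝ) - 1) - 1) / 2) (t ^ 2) * f t := by
  induction N with
  | zero => exact fun a p => p.1.1.elim0
  | succ N ih =>
    rintro a ⟨⟨i, k⟩, hik⟩
    obtain ⟨i, rfl⟩ := Fin.exists_castSucc_eq.2 (hik.trans_le (Fin.le_last k)).ne
    induction k using Fin.lastCases with
    | last =>
      have hN : 0 < N * b := Nat.mul_pos (Fin.pos i) (NeZero.pos b)
      obtain ⟨n, hn⟩ := Nat.exists_eq_succ_of_ne_zero hN.ne'
      have hn' : (N : ℝ) * b = n + 1 := by exact_mod_cast hn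
      refine ⟨(∫⁻ x : Coord N b, weight R (a + b / 2) x) * ballInt n a, fun f hf => ?_⟩
      have h := hR.lintegral_weight_mul_last N a i hn hf
      -- Here `n = N b - 1` is the number of remaining coordinates of the last column, for a matrix
      -- of size `N + 1`.
      have he : (b : ℝ) * (((N + 1 : ℕ) : ℝ) - 1) - 1 = n := by push_cast; linarith
      rw [he]
      exact h
    | cast k =>
      have hik' : i < k := hik
      obtain ⟨C, hC⟩ := ih (a + b / 2) ⟨(i, k), hik'⟩
      refine ⟨C * ballInt (N * b) a, fun f hf => ?_⟩
      have h := hR.lintegral_weight_succ N a (g := fun x => f (x ⟨(i, k), hik'⟩ 0)) (by fun_prop)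
      rw [hC f hf, mul_right_comm] at h
      -- The exponent is invariant under passing from size `N + 1` and `a` to size `N` and `a +
      -- b/2`.
      have he : a + ((b : ℝ) * (((N + 1 : ℕ) : ℝ) - 1) - 1) / 2 =
          a + b / 2 + ((b : ℝ) * ((N : ℝ) - 1) - 1) / 2 := by push_cast; ring
      rw [he]
      exact h

end

/-! ### From complex to real matrices -/

section Realify

variable {m : Type*} [Fintype m] [DecidableEq m]

/-- The real matrix obtained by replacing each complex entry by its `2 × 2` real matrix. -/
noncomputable def realify (M : Matrix m m ℂ) : Matrix (m × Fin 2) (m × Fin 2) ℝ :=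
  (M.map (Algebra.leftMulMatrix Complex.basisOneI).toRingHom).comp m m (Fin 2) (Fin 2) ℝ

omit [Fintype m] [DecidableEq m] in
lemma realify_apply (M : Matrix m m ℂ) (p q : m × Fin 2) :
    realify M p q =
      !![(M p.1 q.1).re, -(M p.1 q.1).im; (M p.1 q.1).im, (M p.1 q.1).re] p.2 q.2 := by
  rw [← Algebra.leftMulMatrix_complex]
  rfl

/-- The blocks are images under a ring homomorphism from `ℂ`, so the determinant may be taken first
over `ℂ` and then of the resulting `2 × 2` block. -/
lemma det_realify (M : Matrix m m ℂ) : (realify M).det = Complex.normSq M.det := by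
  rw [realify, ← Matrix.det_det]
  change (Algebra.leftMulMatrix Complex.basisOneI M.det).det = _
  rw [Algebra.leftMulMatrix_complex, Matrix.det_fin_two_of, Complex.normSq_apply]
  ring

lemma im_det_eq_zero {M : Matrix m m ℂ} (hM : M.IsHermitian) : M.det.im = 0 := by
  have h := Matrix.det_conjTranspose M
  rw [hM.eq] at h
  exact Complex.conj_eq_iff_im.1 h.symm

lemma det_realify_of_isHermitian {M : Matrix m m ℂ} (hM : M.IsHermitian) :
    (realify M).det = M.det.re ^ 2 := by
  rw [det_realify, Complex.normSq_apply, im_det_eq_zero hM]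
  ring

omit [Fintype m] [DecidableEq m] in
lemma realify_isHermitian {M : Matrix m m ℂ} (hM : M.IsHermitian) : (realify M).IsHermitian := by
  ext ⟨i, c⟩ ⟨j, d⟩
  have h : M i j = star (M j i) := (hM.apply i j).symm
  rw [Matrix.conjTranspose_apply, realify_apply, realify_apply, h]
  fin_cases c <;> fin_cases d <;> simp

omit [DecidableEq m] in
lemma dotProduct_realify_mulVec (M : Matrix m m ℂ) (x : m × Fin 2 → ℝ) :
    x ⬝ᵥ (realify M *ᵥ x) =
      (star (fun j => (⟨x (j, 0), x (j, 1)⟩ : ℂ)) ⬝ᵥ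
        (M *ᵥ fun j => (⟨x (j, 0), x (j, 1)⟩ : ℂ))).re := by
  simp only [dotProduct, Matrix.mulVec, Fintype.sum_prod_type, Fin.sum_univ_two, realify_apply,
    Complex.re_sum, Finset.mul_sum, ← Finset.sum_add_distrib]
  refine Finset.sum_congr rfl fun i _ => Finset.sum_congr rfl fun j _ => ?_
  simp
  ring

omit [DecidableEq m] in
lemma posDef_realify_iff {M : Matrix m m ℂ} (hM : M.IsHermitian) :
    (realify M).PosDef ↔ M.PosDef := by
  rw [posDef_iff_dotProduct_mulVec, posDef_iff_dotProduct_mulVec]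
  constructor
  · rintro ⟨-, h⟩
    refine ⟨hM, fun z hz => ?_⟩
    let x : m × Fin 2 → ℝ := fun p => ![(z p.1).re, (z p.1).im] p.2
    have hx : x ≠ 0 := fun h0 => hz <| funext fun j =>
      Complex.ext (congrFun h0 (j, 0)) (congrFun h0 (j, 1))
    have h1 := h hx
    rw [star_trivial, dotProduct_realify_mulVec] at h1
    rw [Complex.pos_iff]
    exact ⟨h1, (hM.im_star_dotProduct_mulVec_self z).symm⟩
  · rintro ⟨-, h⟩
    refine ⟨realify_isHermitian hM, fun x hx => ?_⟩
    rw [star_trivial, dotProduct_realify_mulVec]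
    refine (Complex.pos_iff.1 (h fun h0 => hx ?_)).1
    ext ⟨j, c⟩
    have h1 := congrFun h0 j
    fin_cases c
    · exact congrArg Complex.re h1
    · exact congrArg Complex.im h1

end Realify

/-! ### The three algebras as Hurwitz frames -/

section HermitianOf

variable {A : Type} [Ring A] [StarRing A] {N b : ℕ} (e : (Fin b → ℝ) → A) (x : Coord N b)

lemma hermitianOf_of_lt {i j : Fin N} (h : i < j) : hermitianOf e x i j = e (x ⟨(i, j), h⟩) := by
  simp [hermitianOf, h]

lemma hermitianOf_of_gt {i j : Fin N} (h : j < i) :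
    hermitianOf e x i j = star (e (x ⟨(j, i), h⟩)) := by
  simp [hermitianOf, h, h.not_gt]

lemma hermitianOf_self (i : Fin N) : hermitianOf e x i i = 1 := by
  simp [hermitianOf]

lemma isHermitian_hermitianOf : (hermitianOf e x).IsHermitian := by
  ext i j
  rw [Matrix.conjTranspose_apply]
  rcases lt_trichotomy i j with h | h | h
  · rw [hermitianOf_of_lt e x h, hermitianOf_of_gt e x h, star_star]
  · subst h; rw [hermitianOf_self, star_one]
  · rw [hermitianOf_of_lt e x h, hermitianOf_of_gt e x h]

end HermitianOf

/-- Right multiplications by `1` and `i` on the complex numbers. -/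
def complexFrame : Fin 2 → Matrix (Fin 2) (Fin 2) ℝ := ![1, !![0, -1; 1, 0]]

/-- Right multiplications by `1`, `i`, `j` and `k` on the quaternions. -/
def quaternionFrame : Fin 4 → Matrix (Fin 4) (Fin 4) ℝ :=
  ![1, !![0, -1, 0, 0; 1, 0, 0, 0; 0, 0, 0, 1; 0, 0, -1, 0],
    !![0, 0, -1, 0; 0, 0, 0, -1; 1, 0, 0, 0; 0, 1, 0, 0],
    !![0, 0, 0, -1; 0, 0, 1, 0; 0, -1, 0, 0; 1, 0, 0, 0]]

/-- Right multiplications by the basis elements of the algebra. -/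
def frame : (F : EntryType) → Fin F.beta → Matrix (Fin F.beta) (Fin F.beta) ℝ
  | .real => fun _ => (1 : Matrix (Fin 1) (Fin 1) ℝ)
  | .complex => complexFrame
  | .quaternion => quaternionFrame

instance (F : EntryType) : NeZero F.beta := by
  cases F <;> exact ⟨by decide⟩

lemma hurwitzFrame_real : HurwitzFrame (fun _ => (1 : Matrix (Fin 1) (Fin 1) ℝ)) where
  zero := rfl
  anticomm c d := by
    rw [Subsingleton.elim c d]
    simp [two_smul]
  comm u d := Commute.one_right _

lemma hurwitzFrame_complex : HurwitzFrame complexFrame where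
  zero := rfl
  anticomm c d := by
    fin_cases c <;> fin_cases d <;> ext i j <;> fin_cases i <;> fin_cases j <;>
      simp [complexFrame, Matrix.mul_apply, Fin.sum_univ_two, one_add_one_eq_two]
  comm u d := by
    fin_cases d <;> ext i j <;> fin_cases i <;> fin_cases j <;>
      simp [complexFrame, leftMul, Matrix.mul_apply, Fin.sum_univ_two, Matrix.mulVec, dotProduct]

lemma leftMul_quaternion (u : Fin 4 → ℝ) :
    leftMul quaternionFrame u =
      !![u 0, -u 1, -u 2, -u 3; u 1, u 0, -u 3, u 2; u 2, u 3, u 0, -u 1; u 3, -u 2, u 1, u 0] := by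
  ext i j
  fin_cases i <;> fin_cases j <;>
    simp [quaternionFrame, leftMul, Matrix.mulVec, dotProduct, Fin.sum_univ_four]

lemma hurwitzFrame_quaternion : HurwitzFrame quaternionFrame where
  zero := rfl
  anticomm c d := by
    fin_cases c <;> fin_cases d <;> ext i j <;> fin_cases i <;> fin_cases j <;>
      simp [quaternionFrame, Matrix.mul_apply, Fin.sum_univ_four, one_add_one_eq_two]
  comm u d := by
    rw [leftMul_quaternion]
    fin_cases d <;> ext i j <;> fin_cases i <;> fin_cases j <;>
      simp [quaternionFrame, Matrix.mul_apply, Fin.sum_univ_four]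

lemma gram_real {N : ℕ} (x : Coord N 1) :
    gram (fun _ => (1 : Matrix (Fin 1) (Fin 1) ℝ)) x =
      (realMatrix x).submatrix (Equiv.prodUnique (Fin N) (Fin 1))
        (Equiv.prodUnique (Fin N) (Fin 1)) := by
  ext ⟨i, c⟩ ⟨j, d⟩
  fin_cases c
  fin_cases d
  simp [gram, leftMul, realMatrix, hermitianOf]

lemma gram_complex {N : ℕ} (x : Coord N 2) :
    gram complexFrame x = realify (complexMatrix x) := by
  ext ⟨i, c⟩ ⟨j, d⟩
  rw [realify_apply]
  rcases lt_trichotomy i j with h | h | h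
  · fin_cases c <;> fin_cases d <;>
      simp [gram, complexFrame, leftMul, complexMatrix, hermitianOf, h, Matrix.mulVec, dotProduct,
        Fin.sum_univ_two]
  · subst h
    fin_cases c <;> fin_cases d <;> simp [gram, complexMatrix, hermitianOf]
  · fin_cases c <;> fin_cases d <;>
      simp [gram, complexFrame, leftMul, complexMatrix, hermitianOf, h, h.not_gt, Matrix.mulVec,
        dotProduct, Fin.sum_univ_two]

/-- The four real components of a quaternion as two real components of two complex numbers. -/
def quadEquiv : Fin 4 ≃ Fin 2 × Fin 2 := (finProdFinEquiv (m := 2) (n := 2)).symm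

/-- The signs of the components of `q` in the first column of its block. -/
def quadSign : Fin 4 → ℝ := ![1, 1, -1, 1]

/-- The quaternion with the given real components. -/
def toQuaternion (u : Fin 4 → ℝ) : Quaternion ℝ := ⟨u 0, u 1, u 2, u 3⟩

lemma components_toQuaternion (u : Fin 4 → ℝ) :
    ![(toQuaternion u).re, (toQuaternion u).imI, (toQuaternion u).imJ, (toQuaternion u).imK] =
      u := by
  ext i; fin_cases i <;> rfl

/-- A quaternion is determined by the first column `(z, -conj w)` of its block, on which left
multiplication acts through blocks. The real coordinates of that column are `re, imI, -imJ, imK`,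
whence the signs. -/
lemma leftMul_quaternion_apply (q : Quaternion ℝ) (c d : Fin 4) :
    leftMul quaternionFrame ![q.re, q.imI, q.imJ, q.imK] c d =
      quadSign c * !![(quaternionBlock q (quadEquiv c).1 (quadEquiv d).1).re,
        -(quaternionBlock q (quadEquiv c).1 (quadEquiv d).1).im;
        (quaternionBlock q (quadEquiv c).1 (quadEquiv d).1).im,
        (quaternionBlock q (quadEquiv c).1 (quadEquiv d).1).re]
          (quadEquiv c).2 (quadEquiv d).2 * quadSign d := by
  have e0 : quadEquiv 0 = (0, 0) := by decide
  have e1 : quadEquiv 1 = (0, 1) := by decide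
  have e2 : quadEquiv 2 = (1, 0) := by decide
  have e3 : quadEquiv 3 = (1, 1) := by decide
  rw [leftMul_quaternion]
  fin_cases c <;> fin_cases d <;> simp [e0, e1, e2, e3, quaternionBlock, quadSign]

lemma leftMul_quaternion_star (q : Quaternion ℝ) (c d : Fin 4) :
    leftMul quaternionFrame
        ![(star q).re, (star q).imI, (star q).imJ, (star q).imK] c d =
      leftMul quaternionFrame ![q.re, q.imI, q.imJ, q.imK] d c := by
  rw [leftMul_quaternion, leftMul_quaternion]
  fin_cases c <;> fin_cases d <;> simp

lemma leftMul_quaternion_one (c d : Fin 4) :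
    leftMul quaternionFrame ![(1 : Quaternion ℝ).re, (1 : Quaternion ℝ).imI,
      (1 : Quaternion ℝ).imJ, (1 : Quaternion ℝ).imK] c d = (1 : Matrix (Fin 4) (Fin 4) ℝ) c d := by
  rw [leftMul_quaternion]
  fin_cases c <;> fin_cases d <;>
    simp [Quaternion.re_one, Quaternion.imI_one, Quaternion.imJ_one, Quaternion.imK_one]

/-- Reindexing the real components of the complex representation. -/
def quadIndex (N : ℕ) : Fin N × Fin 4 ≃ (Fin N × Fin 2) × Fin 2 :=
  ((Equiv.refl _).prodCongr quadEquiv).trans (Equiv.prodAssoc _ _ _).symm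

lemma gram_quaternion {N : ℕ} (x : Coord N 4) :
    gram quaternionFrame x = Matrix.diagonal (fun p : Fin N × Fin 4 => quadSign p.2) *
      (realify (complexify (quaternionMatrix x))).submatrix (quadIndex N) (quadIndex N) *
        Matrix.diagonal (fun p : Fin N × Fin 4 => quadSign p.2) := by
  have key : ∀ (i j : Fin N) (c d : Fin 4),
      (Matrix.diagonal (fun p : Fin N × Fin 4 => quadSign p.2) *
      (realify (complexify (quaternionMatrix x))).submatrix (quadIndex N) (quadIndex N) *
        Matrix.diagonal (fun p : Fin N × Fin 4 => quadSign p.2)) (i, c) (j, d) =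
      leftMul quaternionFrame ![(quaternionMatrix x i j).re,
        (quaternionMatrix x i j).imI, (quaternionMatrix x i j).imJ,
        (quaternionMatrix x i j).imK] c d := by
    intro i j c d
    rw [leftMul_quaternion_apply, Matrix.mul_diagonal, Matrix.diagonal_mul,
      Matrix.submatrix_apply, realify_apply]
    rfl
  ext ⟨i, c⟩ ⟨j, d⟩
  rw [key]
  rcases lt_trichotomy i j with h | h | h
  · have hq : quaternionMatrix x i j = toQuaternion (x ⟨(i, j), h⟩) := hermitianOf_of_lt _ x h
    rw [hq, components_toQuaternion]
    simp [gram, h]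
  · subst h
    have hq : quaternionMatrix x i i = 1 := hermitianOf_self _ x i
    rw [hq, leftMul_quaternion_one]
    simp [gram]
  · have hq : quaternionMatrix x i j = star (toQuaternion (x ⟨(j, i), h⟩)) :=
      hermitianOf_of_gt _ x h
    rw [hq, leftMul_quaternion_star, components_toQuaternion]
    simp [gram, h, h.not_gt]

lemma hurwitzFrame : ∀ F : EntryType, HurwitzFrame (frame F)
  | .real => hurwitzFrame_real
  | .complex => hurwitzFrame_complex
  | .quaternion => hurwitzFrame_quaternion

lemma isHermitian_complexify {N : ℕ} {M : Matrix (Fin N) (Fin N) (Quaternion ℝ)}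
    (hM : M.IsHermitian) : (complexify M).IsHermitian := by
  ext ⟨i, c⟩ ⟨j, d⟩
  have h : M i j = star (M j i) := (hM.apply i j).symm
  rw [Matrix.conjTranspose_apply]
  simp only [complexify, Matrix.of_apply, h]
  fin_cases c <;> fin_cases d <;> simp [quaternionBlock, Complex.ext_iff]

lemma posDef_gram_real_iff {N : ℕ} (x : Coord N 1) :
    (realMatrix x).PosDef ↔ (gram (fun _ => (1 : Matrix (Fin 1) (Fin 1) ℝ)) x).PosDef := by
  rw [gram_real]
  refine ⟨fun h => h.submatrix (Equiv.injective _), fun h => ?_⟩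
  have h' := h.submatrix (Equiv.prodUnique (Fin N) (Fin 1)).symm.injective
  rwa [Matrix.submatrix_submatrix, Equiv.self_comp_symm, Matrix.submatrix_id_id] at h'

lemma det_gram_real {N : ℕ} (x : Coord N 1) :
    (gram (fun _ => (1 : Matrix (Fin 1) (Fin 1) ℝ)) x).det = (realMatrix x).det ^ 1 := by
  rw [gram_real, Matrix.det_submatrix_equiv_self, pow_one]

lemma posDef_gram_complex_iff {N : ℕ} (x : Coord N 2) :
    (complexMatrix x).PosDef ↔ (gram complexFrame x).PosDef := by
  rw [gram_complex, posDef_realify_iff (M := complexMatrix x) (isHermitian_hermitianOf _ x)]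

lemma det_gram_complex {N : ℕ} (x : Coord N 2) :
    (gram complexFrame x).det = (complexMatrix x).det.re ^ 2 := by
  rw [gram_complex,
    det_realify_of_isHermitian (M := complexMatrix x) (isHermitian_hermitianOf _ x)]

lemma isHermitian_complexify_quaternionMatrix {N : ℕ} (x : Coord N 4) :
    (complexify (quaternionMatrix x)).IsHermitian :=
  isHermitian_complexify (isHermitian_hermitianOf _ x)

lemma quadSign_mul_self (c : Fin 4) : quadSign c * quadSign c = 1 := by
  fin_cases c <;> simp [quadSign]

lemma posDef_gram_quaternion_iff {N : ℕ} (x : Coord N 4) :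
    (complexify (quaternionMatrix x)).PosDef ↔ (gram quaternionFrame x).PosDef := by
  have hU : IsUnit (Matrix.diagonal fun p : Fin N × Fin 4 => quadSign p.2) := by
    refine IsUnit.of_mul_eq_one (Matrix.diagonal fun p : Fin N × Fin 4 => quadSign p.2) ?_
    simp [Matrix.diagonal_mul_diagonal, quadSign_mul_self]
  have h1 := hU.posDef_star_left_conjugate_iff (x := (realify
    (complexify (quaternionMatrix x))).submatrix (quadIndex N) (quadIndex N))
  rw [Matrix.star_eq_conjTranspose, Matrix.diagonal_conjTranspose, star_trivial] at h1
  rw [gram_quaternion, h1, ← posDef_realify_iff (isHermitian_complexify_quaternionMatrix x)]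
  refine ⟨fun h => h.submatrix (Equiv.injective _), fun h => ?_⟩
  simpa using h.submatrix (quadIndex N).symm.injective

/-- The sign matrices cancel in the determinant and realification squares it. Positivity is needed
to write that square as the fourth power of the root. -/
lemma det_gram_quaternion {N : ℕ} {x : Coord N 4}
    (h : (complexify (quaternionMatrix x)).PosDef) :
    (gram quaternionFrame x).det = √(complexify (quaternionMatrix x)).det.re ^ 4 := by
  have h0 : 0 < (complexify (quaternionMatrix x)).det.re := (Complex.pos_iff.1 h.det_pos).1
  have hs : (∏ p : Fin N × Fin 4, quadSign p.2) * (∏ p : Fin N × Fin 4, quadSign p.2) = 1 := by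
    simp [← Finset.prod_mul_distrib, quadSign_mul_self]
  rw [gram_quaternion, Matrix.det_mul, Matrix.det_mul, Matrix.det_submatrix_equiv_self,
    det_realify_of_isHermitian (isHermitian_complexify_quaternionMatrix x),
    Matrix.det_diagonal, mul_right_comm, hs, one_mul, show 4 = 2 * 2 from rfl, pow_mul,
    Real.sq_sqrt h0.le]

lemma mem_corrSet_iff : ∀ (F : EntryType) {N : ℕ} (x : Coord N F.beta),
    x ∈ corrSet F N ↔ (gram (frame F) x).PosDef
  | .real, _, x => posDef_gram_real_iff x
  | .complex, _, x => posDef_gram_complex_iff x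
  | .quaternion, _, x => posDef_gram_quaternion_iff x

lemma detR_pos : ∀ (F : EntryType) {N : ℕ} {x : Coord N F.beta}, x ∈ corrSet F N → 0 < detR F x
  | .real, _, _, h => Matrix.PosDef.det_pos h
  | .complex, _, _, h => (Complex.pos_iff.1 (Matrix.PosDef.det_pos h)).1
  | .quaternion, _, _, h => Real.sqrt_pos.2 (Complex.pos_iff.1 (Matrix.PosDef.det_pos h)).1

lemma det_gram_frame : ∀ (F : EntryType) {N : ℕ} {x : Coord N F.beta}, x ∈ corrSet F N →
    (gram (frame F) x).det = detR F x ^ F.beta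
  | .real, _, x, _ => det_gram_real x
  | .complex, _, x, _ => det_gram_complex x
  | .quaternion, _, _, h => det_gram_quaternion h

lemma entryRe_of_lt : ∀ (F : EntryType) {N : ℕ} {j k : Fin N} (h : j < k) (x : Coord N F.beta),
    entryRe F j k x = x ⟨(j, k), h⟩ 0
  | .real, _, _, _, h, x => hermitianOf_of_lt (A := ℝ) (fun v : Fin 1 → ℝ => v 0) x h
  | .complex, _, _, _, h, x => congrArg Complex.re
      (hermitianOf_of_lt (A := ℂ) (fun v : Fin 2 → ℝ => ⟨v 0, v 1⟩) x h)
  | .quaternion, _, _, _, h, x => congrArg (fun q : Quaternion ℝ => q.re)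
      (hermitianOf_of_lt (A := Quaternion ℝ) toQuaternion x h)

lemma entryRe_comm : ∀ (F : EntryType) {N : ℕ} (j k : Fin N) (x : Coord N F.beta),
    entryRe F j k x = entryRe F k j x
  | .real, _, j, k, x => by
    have h : realMatrix x j k = star (realMatrix x k j) :=
      ((isHermitian_hermitianOf _ x).apply j k).symm
    simp [entryRe, h]
  | .complex, _, j, k, x => by
    have h : complexMatrix x j k = star (complexMatrix x k j) :=
      ((isHermitian_hermitianOf _ x).apply j k).symm
    simp [entryRe, h]
  | .quaternion, _, j, k, x => by
    have h : quaternionMatrix x j k = star (quaternionMatrix x k j) :=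
      ((isHermitian_hermitianOf _ x).apply j k).symm
    simp [entryRe, h]

lemma measurable_entryRe (F : EntryType) {N : ℕ} {j k : Fin N} (hjk : j ≠ k) :
    Measurable (entryRe F j k) := by
  rcases lt_or_gt_of_ne hjk with h | h
  · have : entryRe F j k = fun x => x ⟨(j, k), h⟩ 0 := funext (entryRe_of_lt F h)
    rw [this]; fun_prop
  · have : entryRe F j k = fun x => x ⟨(k, j), h⟩ 0 :=
      funext fun x => (entryRe_comm F j k x).trans (entryRe_of_lt F h x)
    rw [this]; fun_prop

/-! ### Law of an entry and moments of the determinant -/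

section

variable (F : EntryType) (N : ℕ)

lemma beta_cast_ne_zero : (F.beta : ℝ) ≠ 0 := Nat.cast_ne_zero.2 (NeZero.ne _)

lemma measurableSet_corrSet : MeasurableSet (corrSet F N) := by
  have h : corrSet F N = {x | weight (frame F) 0 x ≠ 0} := by
    ext x
    rw [mem_corrSet_iff, Set.mem_ofPred_eq, weight_ne_zero_iff]
  rw [h]
  exact ((hurwitzFrame F).measurable_weight N 0) (measurableSet_singleton 0).compl

variable {N}

lemma rpow_det_gram (s : ℝ) {x : Coord N F.beta} (hx : x ∈ corrSet F N) :
    (gram (frame F) x).det ^ (s / F.beta) = detR F x ^ s := by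
  rw [det_gram_frame F hx, ← Real.rpow_natCast_mul (detR_pos F hx).le,
    mul_div_cancel₀ _ (beta_cast_ne_zero F)]

lemma weight_frame (a : ℝ) :
    weight (frame F) a = (corrSet F N).indicator fun x => ENNReal.ofReal (detR F x ^ a) := by
  ext x
  by_cases hx : x ∈ corrSet F N
  · rw [Set.indicator_of_mem hx, weight, if_pos ((mem_corrSet_iff F x).1 hx), rpow_det_gram F a hx]
  · rw [Set.indicator_of_notMem hx, weight, if_neg fun h => hx ((mem_corrSet_iff F x).2 h)]

variable (N)

lemma weightMeasure_eq (a : ℝ) :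
    weightMeasure F N a = volume.withDensity (weight (frame F) a) := by
  rw [weightMeasure, weight_frame, withDensity_indicator (measurableSet_corrSet F N)]

/-- The normalization constant. -/
noncomputable def normConst (a : ℝ) : ℝ :=
  ∏ k ∈ Finset.Icc 1 (N - 1), ∏ l ∈ Finset.range F.beta,
    ProbabilityTheory.beta (a + ((F.beta : ℝ) * (k : ℝ) + 1 - (l : ℝ)) / 2) (1 / 2) ^ k

lemma normConst_pos {a : ℝ} (ha : -1 < a) : 0 < normConst F N a :=
  prod_beta_pow_pos N F.beta ha

lemma lintegral_weight_frame {a : ℝ} (ha : -1 < a) :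
    ∫⁻ x : Coord N F.beta, weight (frame F) a x = ENNReal.ofReal (normConst F N a) :=
  (hurwitzFrame F).lintegral_weight_eq N ha

lemma corrMeasure_eq {a : ℝ} (ha : -1 < a) :
    corrMeasure F N a =
      (ENNReal.ofReal (normConst F N a))⁻¹ • volume.withDensity (weight (frame F) a) := by
  rw [corrMeasure, weightMeasure_eq, withDensity_apply _ MeasurableSet.univ, Measure.restrict_univ,
    lintegral_weight_frame F N ha]

lemma isProbabilityMeasure_corrMeasure {a : ℝ} (ha : -1 < a) :
    IsProbabilityMeasure (corrMeasure F N a) := by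
  refine ⟨?_⟩
  rw [corrMeasure_eq F N ha, Measure.smul_apply, withDensity_apply _ MeasurableSet.univ,
    Measure.restrict_univ, lintegral_weight_frame F N ha, smul_eq_mul]
  exact ENNReal.inv_mul_cancel (ENNReal.ofReal_pos.2 (normConst_pos F N ha)).ne'
    ENNReal.ofReal_ne_top

variable {N}

lemma map_entry_corrMeasure {a : ℝ} (ha : -1 < a) (p : {p : Fin N × Fin N // p.1 < p.2}) :
    (corrMeasure F N a).map (fun x => x p 0) =
      volume.withDensity fun ρ : ℝ => ENNReal.ofReal
        (if |ρ| < 1 then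
          1 / ProbabilityTheory.beta (a + ((F.beta : ℝ) * ((N : ℝ) - 1) + 1) / 2) (1 / 2) *
            (1 - ρ ^ 2) ^ (a + ((F.beta : ℝ) * ((N : ℝ) - 1) - 1) / 2)
        else 0) := by
  set c : ℝ := a + ((F.beta : ℝ) * ((N : ℝ) - 1) - 1) / 2 with hc
  have hc1 : a + ((F.beta : ℝ) * ((N : ℝ) - 1) + 1) / 2 = c + 1 := by rw [hc]; ring
  rw [hc1]
  set B := ProbabilityTheory.beta (c + 1) (1 / 2) with hB
  -- An off-diagonal position forces `N ≥ 2`; with `b ≥ 1` this gives `c ≥ a > -1`, so the beta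
  -- integral is finite.
  have hN : (2 : ℝ) ≤ N := by
    have h1 : p.1.1.val < p.1.2.val := p.2
    have h2 := p.1.2.isLt
    exact_mod_cast (by omega : 2 ≤ N)
  have hb : (1 : ℝ) ≤ F.beta := by exact_mod_cast NeZero.one_le
  have hc2 : -1 < c := by nlinarith
  have hBpos : 0 < B := ProbabilityTheory.beta_pos (by linarith) (by norm_num)
  have hdens : ∀ ρ : ℝ, ENNReal.ofReal (if |ρ| < 1 then 1 / B * (1 - ρ ^ 2) ^ c else 0) =
      (ENNReal.ofReal B)⁻¹ * bump c (ρ ^ 2) := by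
    intro ρ
    rw [bump, ← ENNReal.ofReal_inv_of_pos hBpos]
    simp only [sq_lt_one_iff_abs_lt_one]
    split_ifs with h
    · rw [ENNReal.ofReal_mul (by positivity), one_div]
    · simp
  simp_rw [hdens]
  obtain ⟨C, hC⟩ := (hurwitzFrame F).exists_lintegral_weight_mul N a p
  -- Testing against `1` gives `Z = C * B`, so `C` cancels against the normalisation without being
  -- computed.
  have hZ := hC (fun _ => 1) measurable_const
  simp only [mul_one] at hZ
  rw [lintegral_weight_frame F N ha, ← hc, lintegral_bump_sq hc2, ← hB] at hZ
  have hB0 : ENNReal.ofReal B ≠ 0 := (ENNReal.ofReal_pos.2 hBpos).ne'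
  have hZ0 : ENNReal.ofReal (normConst F N a) ≠ 0 :=
    (ENNReal.ofReal_pos.2 (normConst_pos F N ha)).ne'
  have hC0 : C ≠ 0 := fun h => by rw [h, zero_mul] at hZ; exact hZ0 hZ
  have hCt : C ≠ ⊤ := fun h => by
    rw [h, ENNReal.top_mul hB0] at hZ; exact ENNReal.ofReal_ne_top hZ
  have hm : Measurable fun x : Coord N F.beta => x p 0 := by fun_prop
  ext s hs
  have hs' := hC (s.indicator 1) (measurable_one.indicator hs)
  rw [← hc] at hs'
  rw [Measure.map_apply hm hs, corrMeasure_eq F N ha, Measure.smul_apply,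
    withDensity_apply _ (hm hs), withDensity_apply _ hs, ← lintegral_indicator (hm hs),
    ← lintegral_indicator hs, smul_eq_mul]
  have h1 : ∀ x : Coord N F.beta, ((fun x : Coord N F.beta => x p 0) ⁻¹' s).indicator
      (weight (frame F) a) x = weight (frame F) a x * s.indicator 1 (x p 0) := fun x => by
    by_cases h : x p 0 ∈ s <;> simp [Set.indicator, h]
  have h2 : ∀ ρ : ℝ, s.indicator (fun ρ => (ENNReal.ofReal B)⁻¹ * bump c (ρ ^ 2)) ρ =
      (ENNReal.ofReal B)⁻¹ * (bump c (ρ ^ 2) * s.indicator 1 ρ) := fun ρ => by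
    by_cases h : ρ ∈ s <;> simp [Set.indicator, h]
  simp_rw [h1, h2]
  rw [hs', lintegral_const_mul' _ _ (ENNReal.inv_ne_top.2 hB0), hZ,
    ENNReal.mul_inv (Or.inl hC0) (Or.inl hCt), ← mul_assoc, mul_right_comm C⁻¹,
    ENNReal.inv_mul_cancel hC0 hCt, one_mul]

lemma map_entryRe_corrMeasure {a : ℝ} (ha : -1 < a) {j k : Fin N} (hjk : j ≠ k) :
    (corrMeasure F N a).map (entryRe F j k) =
      volume.withDensity fun ρ : ℝ => ENNReal.ofReal
        (if |ρ| < 1 then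
          1 / ProbabilityTheory.beta (a + ((F.beta : ℝ) * ((N : ℝ) - 1) + 1) / 2) (1 / 2) *
            (1 - ρ ^ 2) ^ (a + ((F.beta : ℝ) * ((N : ℝ) - 1) - 1) / 2)
        else 0) := by
  rcases lt_or_gt_of_ne hjk with h | h
  · rw [← map_entry_corrMeasure F ha ⟨(j, k), h⟩]
    exact congrArg (fun g => (corrMeasure F N a).map g) (funext (entryRe_of_lt F h))
  · rw [← map_entry_corrMeasure F ha ⟨(k, j), h⟩]
    exact congrArg (fun g => (corrMeasure F N a).map g)
      (funext fun x => (entryRe_comm F j k x).trans (entryRe_of_lt F h x))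

variable (N)

/-- Trades `detR`, tied to `gram` only on the correlation set, for a function that is measurable and
nonnegative everywhere; the law is concentrated on that set. -/
lemma detR_rpow_ae_eq (a s : ℝ) :
    (fun x : Coord N F.beta => detR F x ^ s) =ᵐ[corrMeasure F N a]
      fun x => |(gram (frame F) x).det| ^ (s / F.beta) := by
  rw [corrMeasure, weightMeasure]
  refine Measure.ae_smul_measure ((withDensity_absolutelyContinuous _ _).ae_le ?_) _
  filter_upwards [ae_restrict_mem (measurableSet_corrSet F N)] with x hx
  rw [← rpow_det_gram F s hx, abs_of_pos ((mem_corrSet_iff F x).1 hx).det_pos]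

/-- Multiplying the weight of exponent `a` by the `s`-th power of the determinant gives the weight
of exponent `a + s`, so the moment is a ratio of normalisation constants. -/
lemma lintegral_detR_rpow {a s : ℝ} (ha : -1 < a) (hs : -1 < a + s) :
    ∫⁻ x, ENNReal.ofReal (|(gram (frame F) x).det| ^ (s / F.beta)) ∂(corrMeasure F N a) =
      ENNReal.ofReal (normConst F N (a + s) / normConst F N a) := by
  let g : Coord N F.beta → ENNReal :=
    fun x => ENNReal.ofReal (|(gram (frame F) x).det| ^ (s / F.beta))
  have hm : Measurable g :=
    ((continuous_gram (N := N) (frame F)).matrix_det.measurable.norm.pow_const _).ennreal_ofReal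
  have h : ∀ x : Coord N F.beta,
      weight (frame F) a x * g x = weight (frame F) (a + s) x := by
    intro x
    unfold weight
    split_ifs with hx
    · simp only [g]
      rw [abs_of_pos hx.det_pos, ← ENNReal.ofReal_mul (Real.rpow_nonneg hx.det_pos.le _),
        ← Real.rpow_add hx.det_pos, add_div]
    · simp
  change ∫⁻ x, g x ∂(corrMeasure F N a) = _
  rw [corrMeasure_eq F N ha, lintegral_smul_measure,
    lintegral_withDensity_eq_lintegral_mul _ ((hurwitzFrame F).measurable_weight N a) hm]
  simp_rw [Pi.mul_apply, h]
  rw [lintegral_weight_frame F N hs, smul_eq_mul,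
    ENNReal.ofReal_div_of_pos (normConst_pos F N ha), mul_comm]
  rfl

lemma integrable_detR_rpow {a s : ℝ} (ha : -1 < a) (hs : -1 < a + s) :
    Integrable (fun x => detR F x ^ s) (corrMeasure F N a) ∧
      ∫ x, detR F x ^ s ∂(corrMeasure F N a) = normConst F N (a + s) / normConst F N a := by
  have hm : Measurable fun x : Coord N F.beta => |(gram (frame F) x).det| ^ (s / F.beta) :=
    ((continuous_gram (N := N) (frame F)).matrix_det.measurable.norm).pow_const _
  have h0 : ∀ x : Coord N F.beta, 0 ≤ |(gram (frame F) x).det| ^ (s / F.beta) :=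
    fun x => Real.rpow_nonneg (abs_nonneg _) _
  have hl := lintegral_detR_rpow F N ha hs
  rw [integrable_congr (detR_rpow_ae_eq F N a s), integral_congr_ae (detR_rpow_ae_eq F N a s)]
  constructor
  · refine ⟨hm.aestronglyMeasurable, ?_⟩
    rw [hasFiniteIntegral_iff_ofReal (.of_forall h0), hl]
    exact ENNReal.ofReal_lt_top
  · rw [integral_eq_lintegral_of_nonneg_ae (.of_forall h0) hm.aestronglyMeasurable, hl,
      ENNReal.toReal_ofReal (div_nonneg (normConst_pos F N hs).le (normConst_pos F N ha).le)]

end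

end CorrMat

theorem mainTheorem8 (F : CorrMat.EntryType) (N : ℕ) (a : ℝ) (ha : -1 < a) :
    IsProbabilityMeasure (CorrMat.corrMeasure F N a) ∧
    (∀ j k : Fin N, j ≠ k →
      Measurable (CorrMat.entryRe F j k) ∧
      (CorrMat.corrMeasure F N a).map (CorrMat.entryRe F j k) =
        volume.withDensity fun ρ : ℝ => ENNReal.ofReal
          (if |ρ| < 1 then
            1 / ProbabilityTheory.beta (a + ((F.beta : ℝ) * ((N : ℝ) - 1) + 1) / 2) (1 / 2) *
              (1 - ρ ^ 2) ^ (a + ((F.beta : ℝ) * ((N : ℝ) - 1) - 1) / 2)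
          else 0)) ∧
    (∀ s : ℝ, -1 < a + s →
      Integrable (fun x => CorrMat.detR F x ^ s) (CorrMat.corrMeasure F N a) ∧
      ∫ x, CorrMat.detR F x ^ s ∂(CorrMat.corrMeasure F N a) =
        ∏ k ∈ Finset.Icc 1 (N - 1), ∏ l ∈ Finset.range F.beta,
          (ProbabilityTheory.beta (a + s + ((F.beta : ℝ) * (k : ℝ) + 1 - (l : ℝ)) / 2) (1 / 2) /
            ProbabilityTheory.beta (a + ((F.beta : ℝ) * (k : ℝ) + 1 - (l : ℝ)) / 2) (1 / 2)) ^ k) := by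
  refine ⟨CorrMat.isProbabilityMeasure_corrMeasure F N ha, fun j k hjk =>
    ⟨CorrMat.measurable_entryRe F hjk, CorrMat.map_entryRe_corrMeasure F ha hjk⟩, fun s hs => ?_⟩
  obtain ⟨h1, h2⟩ := CorrMat.integrable_detR_rpow F N ha hs
  refine ⟨h1, h2.trans ?_⟩
  simp only [CorrMat.normConst, div_pow, Finset.prod_div_distrib]
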